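/- Let $p,m$ be non-negative integers and let $F_{p,m}=\{\Sigma+\Lambda\Lambda^t:\ \Sigma\in\mathbb{R}^{p\times p}\text{ diagonal and positive definite},\ \Lambda\in\mathbb{R}^{p\times m}\}$ be the parameter space of the factor analysis model $\mathbf{F}_{p,m}$. Let $f\in\mathbb{R}[\psi_{ij},\ 1\le i\le j\le p]$ be an invariant of $\mathbf{F}_{p,m}$, that is, a polynomial with $f(A)=0$ for all $A\in F_{p,m}$ (where $f(A)$ is the value of $f$ at the entries $a_{ij}$, $i\le j$, of the symmetric matrix $A$). Let $\Psi\in\mathbb{R}^{p\times p}$ be a symmetric positive definite matrix such that $f(\Psi)=0$ and such that the gradient $\nabla f=(\partial f/\partial\psi_{ij})_{i\le j}$ does not vanish at $\Psi$. Let $\mu\in\mathbb{R}^p$, and let $X_1,X_2,\ldots$ be independent random vectors with distribution $\mathcal{N}_p(\mu,\Psi)$. For $N\ge 2$ let $$S=S_N=\frac1{N-1}\sum_{k=1}^N(X_k-\bar X)(X_k-\bar X)^t,\qquad \bar X=\frac1N\sum_{k=1}^N X_k,$$ be the sample covariance matrix of $X_1,\dots,X_N$. For a positive semidefinite matrix $A$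 let $\mathrm{Var}_A[f(S)]$ be the variance of $f$ at the sample covariance matrix of $N$ independent $\mathcal{N}_p(0,A)$-distributed random vectors (the mean vector $0$ may be replaced by any other without changing this variance). Let $\mathrm{Var}_S[f(S)]$ be the random variable obtained from this function by substituting the sample covariance matrix $S$ for $A$, and let $$Z_f=\frac{f(S)}{\sqrt{\mathrm{Var}_S[f(S)]}}$$ be the standardized sample invariant (with the convention $Z_f=0$ where $\mathrm{Var}_S[f(S)]=0$). Then, as the sample size $N$ tends to infinity, $Z_f$ converges in distribution to the standard normal distribution $\mathcal{N}(0,1)$. -/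

import Mathlib

noncomputable section

namespace FactorAnalysis

open MeasureTheory ProbabilityTheory

/-- The indeterminates `ψ i j` with `i ≤ j`: one for each entry on or above the diagonal of a
symmetric `p × p` matrix. -/
abbrev Entry (p : ℕ) : Type := {q : Fin p × Fin p // q.1 ≤ q.2}

/-- The values of the indeterminates at a matrix `A`. -/
def entries {p : ℕ} (A : Matrix (Fin p) (Fin p) ℝ) : Entry p → ℝ :=
  fun q => A q.1.1 q.1.2

/-- The value `f(A)` of a polynomial `f` in the indeterminates `ψ i j`, `i ≤ j`, at a symmetric
matrix `A`. -/
def evalAt {p : ℕ} (f : MvPolynomial (Entry p) ℝ) (A : Matrix (Fin p) (Fin p) ℝ) : ℝ :=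
  MvPolynomial.eval (entries A) f

/-- The gradient `∇f(A)`: the vector of all partial derivatives of `f` with respect to the
`p (p + 1) / 2` indeterminates `ψ i j`, `i ≤ j`, evaluated at `A`. -/
def gradAt {p : ℕ} (f : MvPolynomial (Entry p) ℝ) (A : Matrix (Fin p) (Fin p) ℝ) : Entry p → ℝ :=
  fun q => evalAt (MvPolynomial.pderiv q f) A

/-- The parameter space of the factor analysis model with `p` observed and `m` hidden variables:
all matrices `Σ + Λ Λᵗ` with `Σ` diagonal and positive definite and `Λ` a real `p × m` matrix. -/
def parameterSpace (p m : ℕ) : Set (Matrix (Fin p) (Fin p) ℝ) :=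
  {A | ∃ (d : Fin p → ℝ) (L : Matrix (Fin p) (Fin m) ℝ),
    (∀ i, 0 < d i) ∧ A = Matrix.diagonal d + L * L.transpose}

/-- `f` is an invariant of the factor analysis model: it vanishes on the parameter space. -/
def IsInvariant (p m : ℕ) (f : MvPolynomial (Entry p) ℝ) : Prop :=
  ∀ A ∈ parameterSpace p m, evalAt f A = 0

/-- The sample mean of `N` vectors in `ℝᵖ`. -/
def sampleMean {p N : ℕ} (x : Fin N → EuclideanSpace ℝ (Fin p)) : EuclideanSpace ℝ (Fin p) :=
  (1 / (N : ℝ)) • ∑ k, x k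

/-- The sample covariance matrix `S = (N - 1)⁻¹ ∑ₖ (xₖ - x̄) (xₖ - x̄)ᵗ` of `N` vectors in `ℝᵖ`. -/
def sampleCov {p N : ℕ} (x : Fin N → EuclideanSpace ℝ (Fin p)) : Matrix (Fin p) (Fin p) ℝ :=
  (1 / ((N : ℝ) - 1)) •
    ∑ k, Matrix.vecMulVec (fun i => x k i - sampleMean x i) (fun i => x k i - sampleMean x i)

/-- The variance `Var_A[f(S)]` of the sample invariant `f(S)` as a function of the covariance
matrix `A`, where `S` is the sample covariance matrix of `N` independent `N(0, A)`-distributed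
vectors. As `S` does not change when all observations are translated by a common vector, the
variance is the same for samples from `N(μ, A)`, whatever `μ` is. The definition makes sense for
all positive semidefinite `A` (a singular `A` gives a degenerate normal distribution), in particular
for every sample covariance matrix; on these matrices it is the value at `A` of the polynomial that
expresses the variance through the entries of the covariance matrix. -/
def varInvariant {p : ℕ} (f : MvPolynomial (Entry p) ℝ) (N : ℕ)
    (A : Matrix (Fin p) (Fin p) ℝ) : ℝ :=
  variance (fun x : Fin N → EuclideanSpace ℝ (Fin p) => evalAt f (sampleCov x))
    (Measure.pi fun _ : Fin N => multivariateGaussian 0 A)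

/-- The standardized sample invariant `Z_f = f(S) / √Var_S[f(S)]` of a sample `x` of size `N`:
the estimator `Var_S[f(S)]` is the variance function with `S` in place of the true covariance
matrix. -/
def standardizedInvariant {p N : ℕ} (f : MvPolynomial (Entry p) ℝ)
    (x : Fin N → EuclideanSpace ℝ (Fin p)) : ℝ :=
  evalAt f (sampleCov x) / √(varInvariant f N (sampleCov x))

end FactorAnalysis

end

/-! The proof is the delta method, with enough moment control to handle the plug-in variance as
well. Let `B = CFC.sqrt Ψ` and write the sample as `μ + B gₖ` with independent standard normal `gₖ`.
Then `S = B T Bᵗ`, where `T` is the sample covariance matrix of the `gₖ`. Let `U` be the mean of the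
`gₖ gₖᵗ` minus the identity (`gramDev`).

The central estimate is `IsStdSample.exists_remainder_bound`: for all `B` with entries bounded by a
fixed constant, `f(B T Bᵗ) = f(B Bᵗ) + ∑ linCoeff f B i j * U i j + R` with `|R| ≤ ρ N`, where `ρ`
does not depend on `B` and `N * ρ N` has bounded moments. The linear part is a centred mean of
independent copies of a quadratic form, so its variance is exactly `quadVar (linCoeff f B) / N`.

This is used twice. For the fixed `B = CFC.sqrt Ψ`, where `f(B Bᵗ) = 0`, the central limit theorem
shows that `√N f(S)` tends to a centred normal law with variance `v = quadVar (linCoeff f B)`. For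
`B = CFC.sqrt (A N)` with `A N → Ψ`, continuity of the square root shows that `N Var_{A N}[f(S)] →
v`. Since `S → Ψ` almost surely, the second statement applies path by path and gives `N Var_S[f(S)]
→ v` almost surely. Finally `v > 0`, because the Gaussian law has full support and the gradient is
nonzero (`quadVar_linCoeff_pos`), so Slutsky's theorem finishes the proof. -/

noncomputable section

namespace FactorAnalysis

open MeasureTheory ProbabilityTheory Filter Matrix
open scoped ENNReal NNReal Topology MatrixOrder

/-! ### Calculus of sequences with uniformly bounded moments. -/

section MomentBounded

variable {Ω : Type*} [MeasurableSpace Ω] {P : Measure Ω}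

/-- A sequence of random variables all of whose moments are bounded uniformly along the
sequence. -/
def MomentBounded (P : Measure Ω) (W : ℕ → Ω → ℝ) : Prop :=
  (∀ N, AEStronglyMeasurable (W N) P) ∧
    ∀ q : ℕ, q ≠ 0 → ∃ C : ℝ≥0, ∀ N, eLpNorm (W N) q P ≤ C

lemma MomentBounded.add {W V : ℕ → Ω → ℝ} (hW : MomentBounded P W) (hV : MomentBounded P V) :
    MomentBounded P (fun N ω => W N ω + V N ω) := by
  refine ⟨fun N => (hW.1 N).add (hV.1 N), fun q hq => ?_⟩
  obtain ⟨C, hC⟩ := hW.2 q hq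
  obtain ⟨D, hD⟩ := hV.2 q hq
  refine ⟨C + D, fun N => ?_⟩
  refine (eLpNorm_add_le (hW.1 N) (hV.1 N) ?_).trans ?_
  · exact_mod_cast Nat.one_le_iff_ne_zero.2 hq
  · rw [ENNReal.coe_add]
    exact add_le_add (hC N) (hD N)

/-- By Hölder, the `q`-th moment of a product costs the `2q`-th moments of the factors. Closure
under products is the reason for asking for all moments at once. -/
lemma MomentBounded.mul {W V : ℕ → Ω → ℝ} (hW : MomentBounded P W) (hV : MomentBounded P V) :
    MomentBounded P (fun N ω => W N ω * V N ω) := by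
  refine ⟨fun N => (hW.1 N).mul (hV.1 N), fun q hq => ?_⟩
  obtain ⟨C, hC⟩ := hW.2 (2 * q) (by omega)
  obtain ⟨D, hD⟩ := hV.2 (2 * q) (by omega)
  refine ⟨C * D, fun N => ?_⟩
  have hH : ENNReal.HolderTriple ((2 * q : ℕ) : ℝ≥0∞) ((2 * q : ℕ) : ℝ≥0∞) (q : ℝ≥0∞) := by
    constructor
    push_cast
    rw [ENNReal.mul_inv (by simp) (by simp), ← add_mul, ENNReal.inv_two_add_inv_two, one_mul]
  have := eLpNorm_smul_le_mul_eLpNorm (hV.1 N) (hW.1 N) (hpqr := hH)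
  refine this.trans ?_
  rw [ENNReal.coe_mul]
  exact mul_le_mul' (hC N) (hD N)

lemma MomentBounded.mono {W V : ℕ → Ω → ℝ} (hW : MomentBounded P W)
    (hV : ∀ N, AEStronglyMeasurable (V N) P) (h : ∀ N ω, |V N ω| ≤ |W N ω|) :
    MomentBounded P V := by
  refine ⟨hV, fun q hq => ?_⟩
  obtain ⟨C, hC⟩ := hW.2 q hq
  exact ⟨C, fun N => (eLpNorm_mono (h N)).trans (hC N)⟩

lemma MomentBounded.abs {W : ℕ → Ω → ℝ} (hW : MomentBounded P W) :
    MomentBounded P (fun N ω => |W N ω|) :=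
  hW.mono (fun N => (hW.1 N).norm) fun N ω => by simp

lemma MomentBounded.memLp {W : ℕ → Ω → ℝ} (hW : MomentBounded P W) (N : ℕ) {q : ℕ} (hq : q ≠ 0) :
    MemLp (W N) q P := by
  obtain ⟨C, hC⟩ := hW.2 q hq
  exact ⟨hW.1 N, (hC N).trans_lt ENNReal.coe_lt_top⟩

lemma momentBounded_of_le [IsProbabilityMeasure P] {c : ℕ → ℝ} {K : ℝ} (hc : ∀ N, |c N| ≤ K) :
    MomentBounded P (fun N _ => c N) := by
  refine ⟨fun N => aestronglyMeasurable_const, fun q hq => ⟨K.toNNReal, fun N => ?_⟩⟩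
  rw [eLpNorm_const _ (by simpa using hq) (NeZero.ne P)]
  simp only [measure_univ, ENNReal.one_rpow, mul_one]
  rw [Real.enorm_eq_ofReal_abs]
  exact ENNReal.ofReal_le_ofReal (hc N)

lemma momentBounded_const [IsProbabilityMeasure P] (c : ℝ) :
    MomentBounded P (fun _ _ => c) :=
  momentBounded_of_le (c := fun _ => c) (K := |c|) fun _ => le_rfl

lemma MomentBounded.sum [IsProbabilityMeasure P] {ι : Type*} (s : Finset ι) {W : ι → ℕ → Ω → ℝ}
    (hW : ∀ i ∈ s, MomentBounded P (W i)) : MomentBounded P (fun N ω => ∑ i ∈ s, W i N ω) := by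
  classical
  induction s using Finset.induction_on with
  | empty => simpa using momentBounded_const 0
  | insert a s ha ih =>
    simp only [Finset.sum_insert ha]
    exact (hW a (by simp)).add (ih fun i hi => hW i (by simp [hi]))

lemma MomentBounded.pow [IsProbabilityMeasure P] {W : ℕ → Ω → ℝ} (hW : MomentBounded P W) (n : ℕ) :
    MomentBounded P (fun N ω => W N ω ^ n) := by
  induction n with
  | zero => simpa using momentBounded_const 1
  | succ n ih => simpa only [pow_succ] using ih.mul hW

end MomentBounded

/-! ### Moments of sums of independent centred variables. -/

section IidSums

variable {Ω : Type*} [MeasurableSpace Ω] {P : Measure Ω} [IsProbabilityMeasure P]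

lemma integrable_pow_of_forall_memLp {Y : Ω → ℝ} (h : ∀ q : ℕ, MemLp Y q P) (n : ℕ) :
    Integrable (fun ω => Y ω ^ n) P := by
  refine ((h n).integrable_norm_pow').mono ((h n).1.pow n) (ae_of_all _ fun ω => ?_)
  simp

/-- The `j`-th moment of a sum of `N` independent, identically distributed, centred random
variables is at most of order `N ^ ⌊j / 2⌋`. -/
lemma exists_abs_moment_sum_le {Y : ℕ → Ω → ℝ} (hY : ∀ k, Measurable (Y k))
    (hindep : iIndepFun Y P) (hident : ∀ k, IdentDistrib (Y k) (Y 0) P P)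
    (hLp : ∀ q : ℕ, MemLp (Y 0) q P) (h0 : ∫ ω, Y 0 ω ∂P = 0) (j : ℕ) :
    ∃ C : ℝ, 0 ≤ C ∧
      ∀ N : ℕ, |∫ ω, (∑ k ∈ Finset.range N, Y k ω) ^ j ∂P| ≤ C * (N : ℝ) ^ (j / 2) := by
  have hLpk : ∀ k, ∀ q : ℕ, MemLp (Y k) q P := fun k q => (hident k).memLp_iff.2 (hLp q)
  have hS : ∀ N, ∀ q : ℕ, MemLp (fun ω => ∑ k ∈ Finset.range N, Y k ω) q P := fun N q =>
    memLp_finsetSum _ fun k _ => hLpk k q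
  have hYpow : ∀ k n, ∫ ω, Y k ω ^ n ∂P = ∫ ω, Y 0 ω ^ n ∂P := fun k n =>
    ((hident k).comp (measurable_id.pow_const n)).integral_eq
  have hprod : ∀ N a b, IndepFun (fun ω => (∑ k ∈ Finset.range N, Y k ω) ^ a)
      (fun ω => Y N ω ^ b) P := by
    intro N a b
    have h := hindep.indepFun_finsetSum_of_notMem hY (s := Finset.range N) (i := N) (by simp)
    have h2 := h.comp (measurable_id.pow_const a) (measurable_id.pow_const b)
    convert h2 using 1 <;> (ext ω; simp)
  -- Binomial expansion of the last partial sum plus the new summand; independence splits each mixed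
  -- moment.
  have hrec : ∀ N n, ∫ ω, (∑ k ∈ Finset.range (N + 1), Y k ω) ^ n ∂P =
      ∑ m ∈ Finset.range (n + 1), (∫ ω, (∑ k ∈ Finset.range N, Y k ω) ^ m ∂P) *
        (∫ ω, Y 0 ω ^ (n - m) ∂P) * (n.choose m) := by
    intro N n
    simp_rw [Finset.sum_range_succ _ N, add_pow]
    rw [integral_finsetSum]
    · refine Finset.sum_congr rfl fun m _ => ?_
      rw [integral_mul_const, (hprod N m (n - m)).integral_fun_mul_eq_mul_integral
        (integrable_pow_of_forall_memLp (hS N) m).1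
        (integrable_pow_of_forall_memLp (hLpk N) (n - m)).1, hYpow]
    · intro m _
      exact ((hprod N m (n - m)).integrable_mul (integrable_pow_of_forall_memLp (hS N) m)
        (integrable_pow_of_forall_memLp (hLpk N) (n - m))).mul_const _
  induction j using Nat.strong_induction_on with
  | _ j ih =>
  rcases j with _ | _ | n
  · exact ⟨1, zero_le_one, fun N => by simp⟩
  · refine ⟨0, le_rfl, fun N => ?_⟩
    simp only [zero_add, pow_one, zero_mul, abs_nonpos_iff]
    rw [integral_finsetSum _ fun k _ => (hLpk k 1).integrable (by simp)]
    refine Finset.sum_eq_zero fun k _ => ?_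
    simpa [h0] using hYpow k 1
  -- The condition `m ≤ n` sits inside the existential so that `choose` gives constants for every
  -- `m`; the value 0 is a filler.
  · have ih' : ∀ m, ∃ C : ℝ, 0 ≤ C ∧ (m ≤ n → ∀ N : ℕ,
        |∫ ω, (∑ k ∈ Finset.range N, Y k ω) ^ m ∂P| ≤ C * (N : ℝ) ^ (m / 2)) := by
      intro m
      by_cases hm : m ≤ n
      · obtain ⟨C, h1, h2⟩ := ih m (by omega)
        exact ⟨C, h1, fun _ => h2⟩
      · exact ⟨0, le_rfl, fun h => absurd h hm⟩
    choose C hC0 hC using ih'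
    set K : ℝ := ∑ m ∈ Finset.range (n + 1),
      C m * |∫ ω, Y 0 ω ^ (n + 2 - m) ∂P| * ((n + 2).choose m) with hK
    have hK0 : 0 ≤ K := Finset.sum_nonneg fun m _ =>
      mul_nonneg (mul_nonneg (hC0 m) (abs_nonneg _)) (Nat.cast_nonneg _)
    refine ⟨K, hK0, fun N => ?_⟩
    have hdiv : (n + 2) / 2 = n / 2 + 1 := by omega
    rw [show n + 1 + 1 = n + 2 from rfl, hdiv]
    induction N with
    | zero => simp
    | succ N ihN =>
      -- In the recursion the term `m = n + 1` vanishes because the variables are centred, and `m =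
      -- n + 2` is the moment for `N`. The other terms add at most `K (N + 1) ^ (n / 2)`, and
      -- accumulating these increments raises the exponent by one.
      rw [hrec, Finset.sum_range_succ, Finset.sum_range_succ]
      have e1 : n + 2 - (n + 1) = 1 := by omega
      have e2 : n + 2 - (n + 2) = 0 := by omega
      rw [e1, e2]
      simp only [pow_one, h0, mul_zero, zero_mul, add_zero, pow_zero, Nat.choose_self, Nat.cast_one,
        mul_one, integral_const, probReal_univ, smul_eq_mul]
      have hsum : |∑ m ∈ Finset.range (n + 1), (∫ ω, (∑ k ∈ Finset.range N, Y k ω) ^ m ∂P) *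
          (∫ ω, Y 0 ω ^ (n + 2 - m) ∂P) * ((n + 2).choose m)| ≤
            K * ((N : ℝ) + 1) ^ (n / 2) := by
        refine (Finset.abs_sum_le_sum_abs _ _).trans ?_
        rw [hK, Finset.sum_mul]
        refine Finset.sum_le_sum fun m hm => ?_
        rw [abs_mul, abs_mul, Nat.abs_cast]
        have hmn : m ≤ n := by simpa [Nat.lt_succ_iff] using hm
        have h1 := hC m hmn N
        have h2 : (N : ℝ) ^ (m / 2) ≤ ((N : ℝ) + 1) ^ (n / 2) :=
          (pow_le_pow_left₀ (Nat.cast_nonneg _) (by linarith) _).trans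
            (pow_le_pow_right₀ (by linarith [(Nat.cast_nonneg N : (0 : ℝ) ≤ N)])
              (Nat.div_le_div_right hmn))
        have h3 := h1.trans (mul_le_mul_of_nonneg_left h2 (hC0 m))
        calc _ ≤ C m * ((N : ℝ) + 1) ^ (n / 2) * |∫ ω, Y 0 ω ^ (n + 2 - m) ∂P| *
              ((n + 2).choose m) := by gcongr
          _ = _ := by ring
      refine (abs_add_le _ _).trans ?_
      have h4 : (N : ℝ) ^ (n / 2) ≤ ((N : ℝ) + 1) ^ (n / 2) :=
        pow_le_pow_left₀ (Nat.cast_nonneg _) (by linarith) _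
      have h5 : (N : ℝ) ^ (n / 2 + 1) ≤ N * ((N : ℝ) + 1) ^ (n / 2) := by
        rw [pow_succ']
        exact mul_le_mul_of_nonneg_left h4 (Nat.cast_nonneg _)
      have h6 := mul_le_mul_of_nonneg_left h5 hK0
      push_cast
      rw [pow_succ ((N : ℝ) + 1)]
      nlinarith [ihN, hsum, h6]

/-- Normalized sums of independent, identically distributed, centred random variables with finite
moments have uniformly bounded moments. -/
lemma momentBounded_normalized_sum {Y : ℕ → Ω → ℝ} (hY : ∀ k, Measurable (Y k))
    (hindep : iIndepFun Y P) (hident : ∀ k, IdentDistrib (Y k) (Y 0) P P)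
    (hLp : ∀ q : ℕ, MemLp (Y 0) q P) (h0 : ∫ ω, Y 0 ω ∂P = 0) :
    MomentBounded P (fun (N : ℕ) ω => (√(N : ℝ))⁻¹ * ∑ k ∈ Finset.range N, Y k ω) := by
  have hLpk : ∀ k, ∀ q : ℕ, MemLp (Y k) q P := fun k q => (hident k).memLp_iff.2 (hLp q)
  have hS : ∀ N q : ℕ, MemLp (fun ω => (√(N : ℝ))⁻¹ * ∑ k ∈ Finset.range N, Y k ω) q P :=
    fun N q => (memLp_finsetSum _ fun k _ => hLpk k q).const_mul _
  refine ⟨fun N => (hS N 1).1, fun q hq => ?_⟩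
  -- The even exponent `2q` removes absolute values, and the resulting `N ^ q` cancels `√N ^ (2q)`.
  obtain ⟨C, hC0, hC⟩ := exists_abs_moment_sum_le hY hindep hident hLp h0 (2 * q)
  refine ⟨(C ^ ((2 * q : ℕ) : ℝ)⁻¹).toNNReal, fun N => ?_⟩
  have hq2 : ((q : ℕ) : ℝ≥0∞) ≤ ((2 * q : ℕ) : ℝ≥0∞) := by
    exact_mod_cast (by omega : q ≤ 2 * q)
  refine (eLpNorm_le_eLpNorm_of_exponent_le hq2 (hS N 1).1).trans ?_
  have h2q : ((2 * q : ℕ) : ℝ≥0∞) ≠ 0 := by simpa using hq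
  rw [(hS N (2 * q)).eLpNorm_eq_integral_rpow_norm h2q (ENNReal.natCast_ne_top _)]
  refine ENNReal.ofReal_le_ofReal ?_
  rw [ENNReal.toReal_natCast]
  refine Real.rpow_le_rpow (integral_nonneg fun ω => by positivity) ?_ (by positivity)
  have hint : ∀ ω, ‖(√(N : ℝ))⁻¹ * ∑ k ∈ Finset.range N, Y k ω‖ ^ ((2 * q : ℕ) : ℝ) =
      ((N : ℝ) ^ q)⁻¹ * (∑ k ∈ Finset.range N, Y k ω) ^ (2 * q) := by
    intro ω
    rw [Real.rpow_natCast, norm_mul, mul_pow, Real.norm_eq_abs, Real.norm_eq_abs,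
      Even.pow_abs (by simp), Even.pow_abs (by simp), inv_pow, pow_mul (√(N : ℝ)),
      Real.sq_sqrt (Nat.cast_nonneg _)]
  simp_rw [hint]
  rw [integral_const_mul]
  have h1 := (le_abs_self _).trans (hC N)
  rw [Nat.mul_div_cancel_left q (by norm_num)] at h1
  rcases Nat.eq_zero_or_pos N with rfl | hN
  · simpa [hq] using hC0
  · have hN' : (0 : ℝ) < (N : ℝ) ^ q := by positivity
    rw [inv_mul_le_iff₀ hN']
    linarith

end IidSums

/-! ### Taylor expansion of polynomials. -/

/-- First-order Taylor expansion of a polynomial with a remainder that is quadratic in the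
increment and of polynomial growth. -/
lemma exists_abs_taylor_remainder_le {ι : Type*} [Fintype ι] [DecidableEq ι]
    (f : MvPolynomial ι ℝ) :
    ∃ (C : ℝ) (D : ℕ), 0 ≤ C ∧ ∀ (a h : ι → ℝ) (r s : ℝ), (∀ q, |a q| ≤ r) → (∀ q, |h q| ≤ s) →
      0 ≤ r → 0 ≤ s →
      |MvPolynomial.eval (a + h) f| ≤ C * (1 + r + s) ^ D ∧
      |∑ q, h q * MvPolynomial.eval a (MvPolynomial.pderiv q f)| ≤ C * (1 + r + s) ^ D * s ∧
      |MvPolynomial.eval (a + h) f - MvPolynomial.eval a f -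
        ∑ q, h q * MvPolynomial.eval a (MvPolynomial.pderiv q f)| ≤ C * (1 + r + s) ^ D * s ^ 2 := by
  induction f using MvPolynomial.induction_on with
  | C c =>
    refine ⟨|c|, 0, abs_nonneg _, fun a h r s _ _ _ hs => ?_⟩
    have := mul_nonneg (abs_nonneg c) hs
    have := mul_nonneg (abs_nonneg c) (sq_nonneg s)
    simpa using ⟨‹_›, ‹_›⟩
  | add f g hf hg =>
    obtain ⟨C₁, D₁, hC₁, h₁⟩ := hf
    obtain ⟨C₂, D₂, hC₂, h₂⟩ := hg
    refine ⟨C₁ + C₂, D₁ + D₂, by positivity, fun a h r s ha hh hr hs => ?_⟩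
    obtain ⟨a1, a2, a3⟩ := h₁ a h r s ha hh hr hs
    obtain ⟨b1, b2, b3⟩ := h₂ a h r s ha hh hr hs
    have hx : (1 : ℝ) ≤ 1 + r + s := by linarith
    have e1 : C₁ * (1 + r + s) ^ D₁ ≤ C₁ * (1 + r + s) ^ (D₁ + D₂) :=
      mul_le_mul_of_nonneg_left (pow_le_pow_right₀ hx (by omega)) hC₁
    have e2 : C₂ * (1 + r + s) ^ D₂ ≤ C₂ * (1 + r + s) ^ (D₁ + D₂) :=
      mul_le_mul_of_nonneg_left (pow_le_pow_right₀ hx (by omega)) hC₂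
    have hs2 := sq_nonneg s
    simp only [map_add, mul_add, Finset.sum_add_distrib, add_mul]
    refine ⟨(abs_add_le _ _).trans (add_le_add (a1.trans e1) (b1.trans e2)),
      (abs_add_le _ _).trans (add_le_add (a2.trans (mul_le_mul_of_nonneg_right e1 hs))
        (b2.trans (mul_le_mul_of_nonneg_right e2 hs))), ?_⟩
    rw [show ∀ u v w x y z : ℝ, u + v - (w + x) - (y + z) = (u - w - y) + (v - x - z) by
      intros; ring]
    exact (abs_add_le _ _).trans (add_le_add (a3.trans (mul_le_mul_of_nonneg_right e1 hs2))
      (b3.trans (mul_le_mul_of_nonneg_right e2 hs2)))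
  | mul_X f i hf =>
    obtain ⟨C, D, hC, hf⟩ := hf
    refine ⟨2 * C, D + 1, by positivity, fun a h r s ha hh hr hs => ?_⟩
    obtain ⟨a1, a2, a3⟩ := hf a h r s ha hh hr hs
    -- The zero increment bounds `f` at the base point itself.
    obtain ⟨b1, -, -⟩ := hf a 0 r 0 ha (by simp) hr le_rfl
    simp only [add_zero] at b1
    have hx : (1 : ℝ) ≤ 1 + r + s := by linarith
    set L := ∑ q, h q * MvPolynomial.eval a (MvPolynomial.pderiv q f) with hL
    have hsum : ∑ q, h q * MvPolynomial.eval a (MvPolynomial.pderiv q (f * MvPolynomial.X i)) =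
        L * a i + MvPolynomial.eval a f * h i := by
      simp only [Derivation.leibniz, MvPolynomial.pderiv_X, smul_eq_mul, map_add, map_mul,
        MvPolynomial.eval_X, mul_add, Finset.sum_add_distrib]
      rw [add_comm, hL, Finset.sum_mul]
      congr 1
      · exact Finset.sum_congr rfl fun q _ => by ring
      · rw [Finset.sum_eq_single i]
        · simp; ring
        · intro b _ hb
          simp [hb.symm]
        · simp
    rw [hsum]
    simp only [map_mul, MvPolynomial.eval_X, Pi.add_apply]
    set y := (1 + r + s) ^ D with hy
    have hy0 : 0 ≤ y := by positivity
    have b1' : |MvPolynomial.eval a f| ≤ C * y :=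
      b1.trans (mul_le_mul_of_nonneg_left (pow_le_pow_left₀ (by linarith) (by linarith) _) hC)
    have hai := ha i
    have hhi := hh i
    have hCy : 0 ≤ C * y := by positivity
    have hCyr : 0 ≤ C * y * r := by positivity
    have hCys : 0 ≤ C * y * s := by positivity
    have hpow : (1 + r + s) ^ (D + 1) = y * (1 + r + s) := pow_succ _ _
    rw [hpow]
    refine ⟨?_, ?_, ?_⟩
    · rw [abs_mul]
      have : |a i + h i| ≤ r + s := (abs_add_le _ _).trans (add_le_add hai hhi)
      calc _ ≤ (C * y) * (r + s) := by gcongr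
        _ ≤ 2 * C * (y * (1 + r + s)) := by nlinarith
    · refine (abs_add_le _ _).trans ?_
      rw [abs_mul, abs_mul]
      calc _ ≤ (C * y * s) * r + (C * y) * s := by gcongr
        _ ≤ 2 * C * (y * (1 + r + s)) * s := by nlinarith [mul_nonneg hCys hr, mul_nonneg hCys hs]
    -- The remainder of `f * X i` is the remainder of `f` times the shifted variable, plus the
    -- product of the linear part of `f` with the increment `h i`; the latter is quadratic in the
    -- increment.
    · rw [show ∀ u v w x l : ℝ, u * (x + w) - v * x - (l * x + v * w) =
        (u - v - l) * (x + w) + l * w by intros; ring]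
      refine (abs_add_le _ _).trans ?_
      rw [abs_mul, abs_mul]
      have : |a i + h i| ≤ r + s := (abs_add_le _ _).trans (add_le_add hai hhi)
      calc _ ≤ (C * y * s ^ 2) * (r + s) + (C * y * s) * s := by gcongr
        _ ≤ 2 * C * (y * (1 + r + s)) * s ^ 2 := by
          nlinarith [mul_nonneg (mul_nonneg hCys hs) hr, mul_nonneg (mul_nonneg hCys hs) hs,
            mul_nonneg hCys hs]

/-! ### The square root of a positive semidefinite matrix. -/

section SquareRoot

variable {p : ℕ}

lemma transpose_sqrt (A : Matrix (Fin p) (Fin p) ℝ) : (CFC.sqrt A)ᵀ = CFC.sqrt A := by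
  simpa using (nonneg_iff_posSemidef.1 (CFC.sqrt_nonneg A)).isHermitian.eq

/-- The squares in row `i` of the symmetric root sum to `A i i`, and `2t ≤ 1 + t ^ 2`. -/
lemma abs_sqrt_le {A : Matrix (Fin p) (Fin p) ℝ} (hA : A.PosSemidef) (i j : Fin p) :
    |CFC.sqrt A i j| ≤ 1 + A i i := by
  have h := congrFun (congrFun (CFC.sqrt_mul_sqrt_self A hA.nonneg) i) i
  rw [mul_apply] at h
  have h2 : ∀ j, CFC.sqrt A i j * CFC.sqrt A j i = CFC.sqrt A i j ^ 2 := fun j => by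
    rw [sq]
    congr 1
    exact congrFun (congrFun (transpose_sqrt A) i) j
  simp_rw [h2] at h
  have h3 : CFC.sqrt A i j ^ 2 ≤ A i i := by
    rw [← h]
    exact Finset.single_le_sum (f := fun j => CFC.sqrt A i j ^ 2) (fun _ _ => sq_nonneg _)
      (Finset.mem_univ j)
  rw [← sq_abs] at h3
  nlinarith [sq_nonneg (|CFC.sqrt A i j| - 1), abs_nonneg (CFC.sqrt A i j)]

/-- The square root is continuous on the positive semidefinite matrices. -/
lemma continuousOn_sqrt :
    ContinuousOn (fun A : Matrix (Fin p) (Fin p) ℝ => CFC.sqrt A) {A | A.PosSemidef} := by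
  intro A hA
  have hcont : ∀ i j : Fin p, Continuous fun B : Matrix (Fin p) (Fin p) ℝ => B i j := fun i j =>
    continuous_id.matrix_elem i j
  set K : Fin p → ℝ := fun i => 1 + (A i i + 1) with hK
  have hcomp : IsCompact {B : Matrix (Fin p) (Fin p) ℝ | ∀ i j, B i j ∈ Set.Icc (-K i) (K i)} := by
    have : IsCompact (Set.univ.pi fun i : Fin p =>
        (Set.univ.pi fun _ : Fin p => Set.Icc (-K i) (K i))) :=
      isCompact_univ_pi fun i => isCompact_univ_pi fun _ => isCompact_Icc
    have he : {B : Matrix (Fin p) (Fin p) ℝ | ∀ i j, B i j ∈ Set.Icc (-K i) (K i)} =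
        Set.univ.pi fun i : Fin p => Set.univ.pi fun _ : Fin p => Set.Icc (-K i) (K i) := by
      refine Set.ext fun B => ⟨fun h i _ j _ => h i j, fun h i j => ?_⟩
      exact h i (Set.mem_univ i) j (Set.mem_univ j)
    rw [he]
    exact this
  have hA' : Tendsto (fun B : Matrix (Fin p) (Fin p) ℝ => B) (𝓝[{A | A.PosSemidef}] A) (𝓝 A) :=
    nhdsWithin_le_nhds
  -- Compactness argument: near `A` the roots stay in a fixed box, and every cluster point is
  -- positive semidefinite with square `A`, hence equals the root of `A`.
  refine hcomp.tendsto_nhds_of_unique_mapClusterPt ?_ ?_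
  · have h1 : ∀ᶠ B in 𝓝[{A : Matrix (Fin p) (Fin p) ℝ | A.PosSemidef}] A,
        ∀ i, B i i < A i i + 1 := by
      rw [eventually_all]
      intro i
      exact (((hcont i i).tendsto A).comp hA').eventually_lt_const (by linarith)
    filter_upwards [h1, self_mem_nhdsWithin] with B hB hBpsd i j
    have h := abs_le.1 (abs_sqrt_le hBpsd i j)
    have h' := hB i
    simp only [hK]
    exact ⟨by linarith [h.1], by linarith [h.2]⟩
  · intro b _ hb
    obtain ⟨U, hU, hUb⟩ := mapClusterPt_iff_ultrafilter.1 hb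
    have hpsd : b.PosSemidef := by
      have hs : ∀ B : Matrix (Fin p) (Fin p) ℝ, (CFC.sqrt B).PosSemidef := fun B =>
        nonneg_iff_posSemidef.1 (CFC.sqrt_nonneg B)
      rw [posSemidef_iff_dotProduct_mulVec]
      refine ⟨?_, fun x => ?_⟩
      · have h1 : Tendsto (fun B : Matrix (Fin p) (Fin p) ℝ => (CFC.sqrt B)ᴴ) U (𝓝 bᴴ) :=
          (continuous_id.matrix_conjTranspose.tendsto b).comp hUb
        refine tendsto_nhds_unique h1 (hUb.congr fun B => (hs B).isHermitian.symm)
      · have h1 : Tendsto (fun B : Matrix (Fin p) (Fin p) ℝ =>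
            star x ⬝ᵥ (CFC.sqrt B) *ᵥ x) U (𝓝 (star x ⬝ᵥ b *ᵥ x)) := by
          have hc : Continuous fun B : Matrix (Fin p) (Fin p) ℝ => star x ⬝ᵥ B *ᵥ x :=
            continuous_const.dotProduct (continuous_id.matrix_mulVec continuous_const)
          exact (hc.tendsto b).comp hUb
        exact ge_of_tendsto' h1 fun B => (posSemidef_iff_dotProduct_mulVec.1 (hs B)).2 x
    have h2 : Tendsto (fun B : Matrix (Fin p) (Fin p) ℝ => CFC.sqrt B * CFC.sqrt B) U
        (𝓝 (b * b)) := hUb.mul hUb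
    have h3 : (fun B : Matrix (Fin p) (Fin p) ℝ => CFC.sqrt B * CFC.sqrt B) =ᶠ[U] fun B => B :=
      hU (eventually_of_mem self_mem_nhdsWithin fun B hB => CFC.sqrt_mul_sqrt_self B hB.nonneg)
    have h4 : b * b = A := tendsto_nhds_unique (h2.congr' h3) (hA'.mono_left hU)
    exact (CFC.sqrt_unique h4 hpsd.nonneg).symm

end SquareRoot

/-! ### Sample covariance matrices and the variance function. -/

section SampleCov

variable {p N : ℕ}

lemma sampleMean_apply (x : Fin N → EuclideanSpace ℝ (Fin p)) (i : Fin p) :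
    sampleMean x i = (1 / (N : ℝ)) * ∑ k, x k i := by
  simp [sampleMean]

lemma sampleCov_apply (x : Fin N → EuclideanSpace ℝ (Fin p)) (i j : Fin p) :
    sampleCov x i j = (N / ((N : ℝ) - 1)) *
      ((1 / (N : ℝ)) * ∑ k, x k i * x k j -
        ((1 / (N : ℝ)) * ∑ k, x k i) * ((1 / (N : ℝ)) * ∑ k, x k j)) := by
  rcases Nat.eq_zero_or_pos N with rfl | hN
  · simp [sampleCov]
  have hN' : (N : ℝ) ≠ 0 := by positivity
  simp only [sampleCov, Matrix.smul_apply, Matrix.sum_apply, vecMulVec_apply, sampleMean_apply, smul_eq_mul]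
  have : ∀ a b : ℝ, ∑ k, (x k i - a) * (x k j - b) =
      ∑ k, x k i * x k j - b * ∑ k, x k i - a * ∑ k, x k j + N * (a * b) := by
    intro a b
    simp only [sub_mul, mul_sub, Finset.sum_sub_distrib, Finset.mul_sum, Finset.sum_const,
      Finset.card_univ, Fintype.card_fin, nsmul_eq_mul]
    simp only [mul_comm b]
    ring
  rw [this]
  field_simp
  ring

lemma posSemidef_sampleCov (x : Fin N → EuclideanSpace ℝ (Fin p)) : (sampleCov x).PosSemidef := by
  rcases Nat.eq_zero_or_pos N with rfl | hN
  · simpa [sampleCov] using PosSemidef.zero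
  refine (posSemidef_sum _ fun k _ => ?_).smul ?_
  · simpa using posSemidef_vecMulVec_self_star fun i => x k i - sampleMean x i
  · have : (1 : ℝ) ≤ N := by exact_mod_cast hN
    exact div_nonneg zero_le_one (by linarith)

/-- The sample must be nonempty: an empty sample has mean 0, which the translation does not move. -/
lemma sampleMean_affine [NeZero N] (x : Fin N → EuclideanSpace ℝ (Fin p))
    (B : Matrix (Fin p) (Fin p) ℝ) (μ : EuclideanSpace ℝ (Fin p)) :
    sampleMean (fun k => μ + toEuclideanCLM (𝕜 := ℝ) B (x k)) =
      μ + toEuclideanCLM (𝕜 := ℝ) B (sampleMean x) := by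
  have hN : (N : ℝ) ≠ 0 := by exact_mod_cast NeZero.ne N
  simp only [sampleMean, Finset.sum_add_distrib, Finset.sum_const, Finset.card_univ,
    Fintype.card_fin, map_smul, map_sum, smul_add]
  rw [← Nat.cast_smul_eq_nsmul ℝ, smul_smul, one_div, inv_mul_cancel₀ hN, one_smul]

/-- The sample covariance matrix of an affine image of a sample. -/
lemma sampleCov_affine (x : Fin N → EuclideanSpace ℝ (Fin p)) (B : Matrix (Fin p) (Fin p) ℝ)
    (μ : EuclideanSpace ℝ (Fin p)) :
    sampleCov (fun k => μ + toEuclideanCLM (𝕜 := ℝ) B (x k)) = B * sampleCov x * Bᵀ := by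
  rcases Nat.eq_zero_or_pos N with rfl | hN
  · simp [sampleCov]
  have : NeZero N := ⟨hN.ne'⟩
  have h : ∀ k, (fun i => (μ + toEuclideanCLM (𝕜 := ℝ) B (x k)) i -
      sampleMean (fun k => μ + toEuclideanCLM (𝕜 := ℝ) B (x k)) i) =
        B *ᵥ fun i => x k i - sampleMean x i := by
    intro k
    rw [sampleMean_affine]
    ext i
    have : (fun i => x k i - sampleMean x i) = (x k).ofLp - (sampleMean x).ofLp := rfl
    rw [this, mulVec_sub]
    simp
  simp only [sampleCov, h, Matrix.mul_smul, Matrix.smul_mul, Matrix.mul_sum, Matrix.sum_mul]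
  congr 1
  refine Finset.sum_congr rfl fun k _ => ?_
  rw [mul_vecMulVec, vecMulVec_mul, vecMul_transpose]

lemma continuous_sampleCov_apply (i j : Fin p) :
    Continuous fun x : Fin N → EuclideanSpace ℝ (Fin p) => sampleCov x i j := by
  simp only [sampleCov_apply]
  fun_prop

lemma continuous_sampleCov :
    Continuous fun x : Fin N → EuclideanSpace ℝ (Fin p) => sampleCov x :=
  continuous_matrix continuous_sampleCov_apply

lemma continuous_evalAt (f : MvPolynomial (Entry p) ℝ) : Continuous (evalAt f) :=
  (MvPolynomial.continuous_eval f).comp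
    (continuous_pi fun _ => continuous_id.matrix_elem _ _)

/-- The variance of the sample invariant in terms of standard normal samples. -/
lemma varInvariant_eq_variance (f : MvPolynomial (Entry p) ℝ) (N : ℕ)
    (A : Matrix (Fin p) (Fin p) ℝ) :
    varInvariant f N A =
      Var[fun x : Fin N → EuclideanSpace ℝ (Fin p) =>
          evalAt f (CFC.sqrt A * sampleCov x * (CFC.sqrt A)ᵀ);
        Measure.pi fun _ : Fin N => stdGaussian (EuclideanSpace ℝ (Fin p))] := by
  have h1 : (Measure.pi fun _ : Fin N => multivariateGaussian (0 : EuclideanSpace ℝ (Fin p)) A) =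
      (Measure.pi fun _ : Fin N => stdGaussian (EuclideanSpace ℝ (Fin p))).map
        fun x k => 0 + toEuclideanCLM (𝕜 := ℝ) (CFC.sqrt A) (x k) := by
    have hm : Measurable fun x : EuclideanSpace ℝ (Fin p) =>
      0 + toEuclideanCLM (𝕜 := ℝ) (CFC.sqrt A) x := by fun_prop
    have : ∀ _ : Fin N, SigmaFinite ((stdGaussian (EuclideanSpace ℝ (Fin p))).map
        fun x => 0 + toEuclideanCLM (𝕜 := ℝ) (CFC.sqrt A) x) := fun _ => by
      have := Measure.isProbabilityMeasure_map
        (μ := stdGaussian (EuclideanSpace ℝ (Fin p))) hm.aemeasurable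
      infer_instance
    exact (Measure.pi_map_pi (f := fun _ => fun x : EuclideanSpace ℝ (Fin p) =>
      0 + toEuclideanCLM (𝕜 := ℝ) (CFC.sqrt A) x) fun _ => hm.aemeasurable).symm
  rw [varInvariant, h1, variance_map]
  · congr 1
    ext x
    simp only [Function.comp_apply]
    rw [sampleCov_affine]
  · exact ((continuous_evalAt f).comp continuous_sampleCov).measurable.aemeasurable
  · exact (measurable_pi_lambda _ fun k =>
      (by fun_prop : Measurable fun x : EuclideanSpace ℝ (Fin p) =>
        0 + toEuclideanCLM (𝕜 := ℝ) (CFC.sqrt A) x).comp (measurable_pi_apply k)).aemeasurable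

/-- The variance of the sample invariant, computed from an independent sequence of standard normal
random vectors. -/
lemma varInvariant_eq_variance_of_hasLaw {Ω : Type*} [MeasurableSpace Ω] {P : Measure Ω}
    [IsProbabilityMeasure P] {g : ℕ → Ω → EuclideanSpace ℝ (Fin p)} (hg : ∀ k, Measurable (g k))
    (hindep : iIndepFun g P)
    (hlaw : ∀ k, P.map (g k) = stdGaussian (EuclideanSpace ℝ (Fin p)))
    (f : MvPolynomial (Entry p) ℝ) (N : ℕ) (A : Matrix (Fin p) (Fin p) ℝ) :
    varInvariant f N A =
      Var[fun ω => evalAt f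
        (CFC.sqrt A * sampleCov (fun k : Fin N => g k ω) * (CFC.sqrt A)ᵀ); P] := by
  have h1 : (Measure.pi fun _ : Fin N => stdGaussian (EuclideanSpace ℝ (Fin p))) =
      P.map fun ω (k : Fin N) => g k ω := by
    rw [(iIndepFun_iff_map_fun_eq_pi_map (fun k : Fin N => (hg k).aemeasurable)).1
      (hindep.precomp Fin.val_injective)]
    simp [hlaw]
  rw [varInvariant_eq_variance, h1, variance_map]
  · rfl
  · have : Continuous fun x : Fin N → EuclideanSpace ℝ (Fin p) =>
        CFC.sqrt A * sampleCov x * (CFC.sqrt A)ᵀ :=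
      (continuous_const.matrix_mul continuous_sampleCov).matrix_mul continuous_const
    exact ((continuous_evalAt f).comp this).measurable.aemeasurable
  · exact (measurable_pi_lambda _ fun k : Fin N => hg k).aemeasurable

/-- The plug-in variance is measurable. -/
lemma measurable_varInvariant {Ω : Type*} [MeasurableSpace Ω] (f : MvPolynomial (Entry p) ℝ) (N : ℕ)
    {S : Ω → Matrix (Fin p) (Fin p) ℝ} (hS : ∀ i j, Measurable fun ω => S ω i j)
    (hpsd : ∀ ω, (S ω).PosSemidef) : Measurable fun ω => varInvariant f N (S ω) := by
  set ν := Measure.pi fun _ : Fin N => stdGaussian (EuclideanSpace ℝ (Fin p)) with hν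
  have hF : Continuous fun z : (Fin p → Fin p → ℝ) × (Fin N → EuclideanSpace ℝ (Fin p)) =>
      evalAt f (of z.1 * sampleCov z.2 * (of z.1)ᵀ) := by
    refine (continuous_evalAt f).comp ?_
    have h1 : Continuous fun z : (Fin p → Fin p → ℝ) × (Fin N → EuclideanSpace ℝ (Fin p)) =>
        of z.1 := continuous_fst
    exact (h1.matrix_mul (continuous_sampleCov.comp continuous_snd)).matrix_mul h1.matrix_transpose
  have h1 : StronglyMeasurable fun B : Fin p → Fin p → ℝ =>
      ∫ x, evalAt f (of B * sampleCov x * (of B)ᵀ) ∂ν :=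
    hF.stronglyMeasurable.integral_prod_right
  have h2 : StronglyMeasurable fun B : Fin p → Fin p → ℝ =>
      ∫ y, (evalAt f (of B * sampleCov y * (of B)ᵀ) -
        ∫ x, evalAt f (of B * sampleCov x * (of B)ᵀ) ∂ν) ^ 2 ∂ν := by
    refine StronglyMeasurable.integral_prod_right (f := fun B y =>
      (evalAt f (of B * sampleCov y * (of B)ᵀ) -
        ∫ x, evalAt f (of B * sampleCov x * (of B)ᵀ) ∂ν) ^ 2) ?_
    exact (hF.stronglyMeasurable.sub (h1.comp_measurable measurable_fst)).pow 2
  -- Continuity of the root is known only on positive semidefinite matrices, so the composition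
  -- passes through that subtype.
  have h3 : Continuous fun A : {A : Fin p → Fin p → ℝ // (of A).PosSemidef} =>
      of.symm (CFC.sqrt (of A.1)) :=
    continuousOn_iff_continuous_domRestrict.1 continuousOn_sqrt
  have h4 : Measurable fun ω =>
      (⟨of.symm (S ω), hpsd ω⟩ : {A : Fin p → Fin p → ℝ // (of A).PosSemidef}) :=
    Measurable.subtype_mk (measurable_pi_lambda _ fun i => measurable_pi_lambda _ fun j => hS i j)
  have h5 := h2.measurable.comp (h3.measurable.comp h4)
  convert h5 using 1
  ext ω
  rw [varInvariant_eq_variance, variance_eq_integral]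
  · rfl
  · have : Continuous fun x : Fin N → EuclideanSpace ℝ (Fin p) =>
        CFC.sqrt (S ω) * sampleCov x * (CFC.sqrt (S ω))ᵀ :=
      (continuous_const.matrix_mul continuous_sampleCov).matrix_mul continuous_const
    exact ((continuous_evalAt f).comp this).measurable.aemeasurable

end SampleCov

/-! ### Linearization of the invariant, uniform in bounded `B`. -/

section Expansion

variable {p : ℕ}

/-- The coefficients of the linearization of `T ↦ f(B T Bᵗ)` at the identity matrix. -/
def linCoeff (f : MvPolynomial (Entry p) ℝ) (B : Matrix (Fin p) (Fin p) ℝ) (i j : Fin p) : ℝ :=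
  ∑ q : Entry p, B q.1.1 i * B q.1.2 j * gradAt f (B * Bᵀ) q

lemma continuous_gradAt (f : MvPolynomial (Entry p) ℝ) (q : Entry p) :
    Continuous fun A => gradAt f A q :=
  continuous_evalAt _

lemma continuous_linCoeff (f : MvPolynomial (Entry p) ℝ) (i j : Fin p) :
    Continuous fun B => linCoeff f B i j := by
  refine continuous_finsetSum _ fun q _ => ?_
  refine ((continuous_id.matrix_elem _ _).mul (continuous_id.matrix_elem _ _)).mul ?_
  exact (continuous_gradAt f q).comp (continuous_id.matrix_mul continuous_id.matrix_transpose)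

lemma mul_mul_transpose_apply (B H : Matrix (Fin p) (Fin p) ℝ) (a b : Fin p) :
    (B * H * Bᵀ) a b = ∑ i, ∑ j, B a i * B b j * H i j := by
  simp only [mul_apply, Finset.sum_mul, transpose_apply]
  rw [Finset.sum_comm]
  exact Finset.sum_congr rfl fun i _ => Finset.sum_congr rfl fun j _ => by ring

/-- Chain rule behind `linCoeff`: both sides are the derivative of `T ↦ f(B T Bᵗ)` at the identity
in the direction `H`. -/
lemma sum_mul_gradAt_eq (f : MvPolynomial (Entry p) ℝ) (B H : Matrix (Fin p) (Fin p) ℝ) :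
    ∑ q, entries (B * H * Bᵀ) q * gradAt f (B * Bᵀ) q = ∑ i, ∑ j, linCoeff f B i j * H i j := by
  simp only [entries, mul_mul_transpose_apply, linCoeff, Finset.sum_mul]
  rw [Finset.sum_comm]
  refine Finset.sum_congr rfl fun i _ => ?_
  rw [Finset.sum_comm]
  exact Finset.sum_congr rfl fun j _ => Finset.sum_congr rfl fun q _ => by ring

/-- Uniform expansion of `T ↦ f(B T Bᵗ)` around the identity matrix, where the increment `T - 1`
in the linear part may be replaced by an approximation `U`. -/
lemma exists_abs_sub_linearization_le (f : MvPolynomial (Entry p) ℝ) {K : ℝ} (hK : 0 ≤ K) :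
    ∃ (C : ℝ) (D : ℕ), 0 ≤ C ∧ ∀ B T U : Matrix (Fin p) (Fin p) ℝ, (∀ i j, |B i j| ≤ K) →
      |evalAt f (B * T * Bᵀ) - evalAt f (B * Bᵀ) - ∑ i, ∑ j, linCoeff f B i j * U i j| ≤
        C * ((1 + ∑ i, ∑ j, |(T - 1) i j|) ^ D * (∑ i, ∑ j, |(T - 1) i j|) ^ 2 +
          ∑ i, ∑ j, |(T - 1 - U) i j|) := by
  classical
  obtain ⟨C, D, hC, h⟩ := exists_abs_taylor_remainder_le f
  set r : ℝ := p * K ^ 2 with hr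
  have hr0 : 0 ≤ r := by positivity
  set C₁ : ℝ := C * (1 + r + K ^ 2) ^ D with hC₁
  have hC₁0 : 0 ≤ C₁ := by positivity
  refine ⟨C₁ * (K ^ 2) ^ 2 + C₁ * K ^ 2, D, by positivity, fun B T U hB => ?_⟩
  set η : ℝ := ∑ i, ∑ j, |(T - 1) i j| with hη
  set θ : ℝ := ∑ i, ∑ j, |(T - 1 - U) i j| with hθ
  have hη0 : 0 ≤ η := Finset.sum_nonneg fun i _ => Finset.sum_nonneg fun j _ => abs_nonneg _
  have hθ0 : 0 ≤ θ := Finset.sum_nonneg fun i _ => Finset.sum_nonneg fun j _ => abs_nonneg _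
  have hBB : ∀ a b i j, |B a i * B b j| ≤ K ^ 2 := fun a b i j => by
    rw [abs_mul, sq]
    exact mul_le_mul (hB _ _) (hB _ _) (abs_nonneg _) hK
  have ha : ∀ q, |entries (B * Bᵀ) q| ≤ r := fun q => by
    simp only [entries, mul_apply, transpose_apply]
    refine (Finset.abs_sum_le_sum_abs _ _).trans ((Finset.sum_le_sum fun i _ => hBB _ _ _ _).trans ?_)
    simp [hr]
  have hh : ∀ q, |entries (B * (T - 1) * Bᵀ) q| ≤ K ^ 2 * η := fun q => by
    simp only [entries, mul_mul_transpose_apply, hη, Finset.mul_sum]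
    refine (Finset.abs_sum_le_sum_abs _ _).trans (Finset.sum_le_sum fun i _ => ?_)
    refine (Finset.abs_sum_le_sum_abs _ _).trans (Finset.sum_le_sum fun j _ => ?_)
    rw [abs_mul]
    exact mul_le_mul_of_nonneg_right (hBB _ _ _ _) (abs_nonneg _)
  -- Each coefficient is itself a directional derivative of `f`, along the increment `q ↦ B q.1.1 i
  -- * B q.1.2 j`, so the first-order bound applies to it.
  have hc : ∀ i j, |linCoeff f B i j| ≤ C₁ * K ^ 2 := fun i j =>
    (h (entries (B * Bᵀ)) (fun q => B q.1.1 i * B q.1.2 j) r (K ^ 2) ha (fun q => hBB _ _ _ _) hr0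
      (by positivity)).2.1
  obtain ⟨-, -, h3⟩ := h (entries (B * Bᵀ)) (entries (B * (T - 1) * Bᵀ)) r (K ^ 2 * η) ha hh hr0
    (by positivity)
  have hadd : entries (B * Bᵀ) + entries (B * (T - 1) * Bᵀ) = entries (B * T * Bᵀ) := by
    funext q
    simp [entries, Matrix.mul_sub, Matrix.sub_mul]
  rw [hadd] at h3
  have hlin := sum_mul_gradAt_eq f B (T - 1)
  simp only [gradAt, evalAt] at hlin
  rw [hlin] at h3
  have h4 : |∑ i, ∑ j, linCoeff f B i j * (T - 1 - U) i j| ≤ C₁ * K ^ 2 * θ := by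
    rw [hθ]
    simp only [Finset.mul_sum]
    refine (Finset.abs_sum_le_sum_abs _ _).trans (Finset.sum_le_sum fun i _ => ?_)
    refine (Finset.abs_sum_le_sum_abs _ _).trans (Finset.sum_le_sum fun j _ => ?_)
    rw [abs_mul]
    exact mul_le_mul_of_nonneg_right (hc i j) (abs_nonneg _)
  have h5 : ∑ i, ∑ j, linCoeff f B i j * (T - 1 - U) i j =
      ∑ i, ∑ j, linCoeff f B i j * (T - 1) i j - ∑ i, ∑ j, linCoeff f B i j * U i j := by
    simp only [← Finset.sum_sub_distrib]
    exact Finset.sum_congr rfl fun i _ => Finset.sum_congr rfl fun j _ => by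
      rw [Matrix.sub_apply (T - 1) U, mul_sub]
  rw [h5] at h4
  -- This rests on `1 + r + K ^ 2 * η ≤ (1 + r + K ^ 2) * (1 + η)`, which separates the fixed
  -- constants from `η`.
  have h6 : C * (1 + r + K ^ 2 * η) ^ D * (K ^ 2 * η) ^ 2 ≤
      C₁ * (K ^ 2) ^ 2 * ((1 + η) ^ D * η ^ 2) := by
    have : (1 + r + K ^ 2 * η) ^ D ≤ (1 + r + K ^ 2) ^ D * (1 + η) ^ D := by
      rw [← mul_pow]
      refine pow_le_pow_left₀ (by positivity) ?_ _
      nlinarith [mul_nonneg hr0 hη0, sq_nonneg K]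
    calc _ ≤ C * ((1 + r + K ^ 2) ^ D * (1 + η) ^ D) * (K ^ 2 * η) ^ 2 := by gcongr
      _ = _ := by rw [hC₁]; ring
  have h7 : 0 ≤ (1 + η) ^ D * η ^ 2 := by positivity
  simp only [evalAt]
  rw [show ∀ a b u t : ℝ, a - b - u = (a - b - t) + (t - u) by intros; ring]
  refine (abs_add_le _ _).trans ((add_le_add (h3.trans h6) h4).trans ?_)
  have h8 : 0 ≤ C₁ * K ^ 2 := by positivity
  have h9 : 0 ≤ C₁ * (K ^ 2) ^ 2 := by positivity
  nlinarith [mul_nonneg h8 h7, mul_nonneg h9 hθ0]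

end Expansion

/-! ### Standard normal samples and the stochastic remainder. -/

section Sample

variable {p : ℕ} {Ω : Type*}

/-- The deviation of the mean of the matrices `gₖ gₖᵗ` from the identity matrix. -/
def gramDev (g : ℕ → Ω → EuclideanSpace ℝ (Fin p)) (N : ℕ) (ω : Ω) :
    Matrix (Fin p) (Fin p) ℝ :=
  of fun i j => (1 / (N : ℝ)) * ∑ k ∈ Finset.range N, g k ω i * g k ω j -
    (1 : Matrix (Fin p) (Fin p) ℝ) i j

/-- The coordinates of the mean of the first `N` vectors. -/
def coordMean (g : ℕ → Ω → EuclideanSpace ℝ (Fin p)) (N : ℕ) (ω : Ω) (i : Fin p) : ℝ :=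
  (1 / (N : ℝ)) * ∑ k ∈ Finset.range N, g k ω i

lemma sampleCov_eq (g : ℕ → Ω → EuclideanSpace ℝ (Fin p)) (N : ℕ) (ω : Ω) (i j : Fin p) :
    sampleCov (fun k : Fin N => g k ω) i j = N / ((N : ℝ) - 1) *
      (gramDev g N ω i j + (1 : Matrix (Fin p) (Fin p) ℝ) i j -
        coordMean g N ω i * coordMean g N ω j) := by
  rw [sampleCov_apply, gramDev, coordMean, coordMean, of_apply, sub_add_cancel,
    Fin.sum_univ_eq_sum_range (fun k => g k ω i * g k ω j), Fin.sum_univ_eq_sum_range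
    (fun k => g k ω i), Fin.sum_univ_eq_sum_range (fun k => g k ω j)]

lemma integral_apply_stdGaussian (i : Fin p) :
    ∫ x : EuclideanSpace ℝ (Fin p), x i ∂(stdGaussian (EuclideanSpace ℝ (Fin p))) = 0 :=
  integral_strongDual_stdGaussian (EuclideanSpace.proj i : StrongDual ℝ (EuclideanSpace ℝ (Fin p)))

lemma memLp_apply_stdGaussian (i : Fin p) (q : ℕ) :
    MemLp (fun x : EuclideanSpace ℝ (Fin p) => x i) q (stdGaussian (EuclideanSpace ℝ (Fin p))) :=
  (IsGaussian.memLp_id (stdGaussian (EuclideanSpace ℝ (Fin p))) q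
    (ENNReal.natCast_ne_top _)).continuousLinearMap_comp
      (EuclideanSpace.proj i : StrongDual ℝ (EuclideanSpace ℝ (Fin p)))

lemma memLp_mul_apply_stdGaussian (i j : Fin p) (q : ℕ) :
    MemLp (fun x : EuclideanSpace ℝ (Fin p) => x i * x j) q
      (stdGaussian (EuclideanSpace ℝ (Fin p))) := by
  have hH : ENNReal.HolderTriple ((2 * q : ℕ) : ℝ≥0∞) ((2 * q : ℕ) : ℝ≥0∞) (q : ℝ≥0∞) := by
    constructor
    push_cast
    rw [ENNReal.mul_inv (by simp) (by simp), ← add_mul, ENNReal.inv_two_add_inv_two, one_mul]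
  exact (memLp_apply_stdGaussian j (2 * q)).mul (memLp_apply_stdGaussian i (2 * q)) (hpqr := hH)

lemma integral_mul_apply_stdGaussian (i j : Fin p) :
    ∫ x : EuclideanSpace ℝ (Fin p), x i * x j ∂(stdGaussian (EuclideanSpace ℝ (Fin p))) =
      (1 : Matrix (Fin p) (Fin p) ℝ) i j := by
  have h := covariance_eval_multivariateGaussian (μ := (0 : EuclideanSpace ℝ (Fin p)))
    (PosSemidef.one (n := Fin p) (R := ℝ)) i j
  rw [multivariateGaussian_zero_one, covariance_eq_sub (memLp_apply_stdGaussian i 2)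
    (memLp_apply_stdGaussian j 2), integral_apply_stdGaussian, zero_mul, sub_zero] at h
  exact h

variable [MeasurableSpace Ω]

/-- An independent sequence of standard normal random vectors. -/
structure IsStdSample (P : Measure Ω) (g : ℕ → Ω → EuclideanSpace ℝ (Fin p)) : Prop where
  measurable : ∀ k, Measurable (g k)
  indep : iIndepFun g P
  map_eq : ∀ k, P.map (g k) = stdGaussian (EuclideanSpace ℝ (Fin p))

variable {P : Measure Ω} {g : ℕ → Ω → EuclideanSpace ℝ (Fin p)}

lemma IsStdSample.identDistrib (hg : IsStdSample P g)
    {φ : EuclideanSpace ℝ (Fin p) → ℝ} (hφ : Measurable φ) (k : ℕ) :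
    IdentDistrib (fun ω => φ (g k ω)) (fun ω => φ (g 0 ω)) P P :=
  IdentDistrib.comp (f := g k) (g := g 0)
    ⟨(hg.measurable k).aemeasurable, (hg.measurable 0).aemeasurable,
      by rw [hg.map_eq, hg.map_eq]⟩ hφ

lemma IsStdSample.iIndepFun_comp (hg : IsStdSample P g)
    {φ : EuclideanSpace ℝ (Fin p) → ℝ} (hφ : Measurable φ) :
    iIndepFun (fun k ω => φ (g k ω)) P :=
  hg.indep.comp (fun _ => φ) fun _ => hφ

lemma IsStdSample.integral_comp (hg : IsStdSample P g)
    {φ : EuclideanSpace ℝ (Fin p) → ℝ} (hφ : Measurable φ) (k : ℕ) :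
    ∫ ω, φ (g k ω) ∂P = ∫ x, φ x ∂(stdGaussian (EuclideanSpace ℝ (Fin p))) := by
  rw [← hg.map_eq k, integral_map (hg.measurable k).aemeasurable hφ.aestronglyMeasurable]

lemma IsStdSample.memLp_comp (hg : IsStdSample P g)
    {φ : EuclideanSpace ℝ (Fin p) → ℝ} {q : ℝ≥0∞}
    (hL : MemLp φ q (stdGaussian (EuclideanSpace ℝ (Fin p)))) (k : ℕ) :
    MemLp (fun ω => φ (g k ω)) q P := by
  rw [← hg.map_eq k] at hL
  exact hL.comp_of_map (hg.measurable k).aemeasurable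

lemma IsStdSample.measurable_gramDev (hg : IsStdSample P g) (N : ℕ) (i j : Fin p) :
    Measurable fun ω => gramDev g N ω i j := by
  have : Measurable fun ω => ∑ k ∈ Finset.range N, g k ω i * g k ω j :=
    Finset.measurable_sum _ fun k _ =>
      (by fun_prop : Measurable fun x : EuclideanSpace ℝ (Fin p) => x i * x j).comp
        (hg.measurable k)
  exact (this.const_mul _).sub_const _

lemma IsStdSample.measurable_coordMean (hg : IsStdSample P g) (N : ℕ) (i : Fin p) :
    Measurable fun ω => coordMean g N ω i := by
  have : Measurable fun ω => ∑ k ∈ Finset.range N, g k ω i :=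
    Finset.measurable_sum _ fun k _ =>
      (by fun_prop : Measurable fun x : EuclideanSpace ℝ (Fin p) => x i).comp
        (hg.measurable k)
  exact this.const_mul _

variable [IsProbabilityMeasure P]

/-- Normalized sums of a centred function of the vectors of a standard sample. -/
lemma IsStdSample.momentBounded (hg : IsStdSample P g)
    {φ : EuclideanSpace ℝ (Fin p) → ℝ} (hφ : Measurable φ)
    (hL : ∀ q : ℕ, MemLp φ q (stdGaussian (EuclideanSpace ℝ (Fin p)))) :
    MomentBounded P (fun (N : ℕ) ω => √(N : ℝ) * ((1 / (N : ℝ)) *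
      ∑ k ∈ Finset.range N, φ (g k ω) - ∫ x, φ x ∂(stdGaussian (EuclideanSpace ℝ (Fin p))))) := by
  set c := ∫ x, φ x ∂(stdGaussian (EuclideanSpace ℝ (Fin p))) with hc
  have hφ' : Measurable fun x => φ x - c := hφ.sub_const c
  have hL' : ∀ q : ℕ, MemLp (fun x => φ x - c) q (stdGaussian (EuclideanSpace ℝ (Fin p))) :=
    fun q => (hL q).sub (memLp_const c)
  have h := momentBounded_normalized_sum (Y := fun k ω => φ (g k ω) - c) (P := P)
    (fun k => hφ'.comp (hg.measurable k)) (hg.iIndepFun_comp hφ') (hg.identDistrib hφ')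
    (fun q => hg.memLp_comp (hL' q) 0) (by
      rw [hg.integral_comp hφ' 0, integral_sub ((hL 1).integrable (by simp)) (integrable_const c)]
      simp [hc])
  refine h.mono (fun N => ?_) fun N ω => le_of_eq ?_
  · have : Measurable fun ω => ∑ k ∈ Finset.range N, φ (g k ω) :=
      Finset.measurable_sum _ fun k _ => hφ.comp (hg.measurable k)
    exact (((this.const_mul _).sub_const _).const_mul _).aestronglyMeasurable
  · congr 1
    rcases Nat.eq_zero_or_pos N with rfl | hN
    · simp
    · have hN' : (0 : ℝ) < N := by exact_mod_cast hN
      have hs : √(N : ℝ) ≠ 0 := (Real.sqrt_pos.2 hN').ne'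
      have hs2 : √(N : ℝ) * √(N : ℝ) = N := Real.mul_self_sqrt hN'.le
      simp only [Finset.sum_sub_distrib, Finset.sum_const, Finset.card_range, nsmul_eq_mul]
      field_simp
      rw [sq, hs2]

lemma IsStdSample.momentBounded_gramDev (hg : IsStdSample P g) (i j : Fin p) :
    MomentBounded P (fun (N : ℕ) ω => √(N : ℝ) * gramDev g N ω i j) := by
  have h := hg.momentBounded (φ := fun x => x i * x j) (by fun_prop)
    (memLp_mul_apply_stdGaussian i j)
  rw [integral_mul_apply_stdGaussian] at h
  exact h

lemma IsStdSample.momentBounded_coordMean (hg : IsStdSample P g) (i : Fin p) :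
    MomentBounded P (fun (N : ℕ) ω => √(N : ℝ) * coordMean g N ω i) := by
  have h := hg.momentBounded (φ := fun x => x i) (by fun_prop) (memLp_apply_stdGaussian i)
  simp only [integral_apply_stdGaussian, sub_zero] at h
  exact h

/-- Up to terms with bounded moments divided by `N`, the function `f(B T Bᵗ)` of the sample
covariance matrix `T` of a standard sample is affine in the Gram matrix, uniformly in bounded
`B`. -/
lemma IsStdSample.exists_remainder_bound (hg : IsStdSample P g) (f : MvPolynomial (Entry p) ℝ)
    {K : ℝ} (hK : 0 ≤ K) :
    ∃ ρ : ℕ → Ω → ℝ, MomentBounded P (fun N ω => N * ρ N ω) ∧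
      ∀ (N : ℕ) (ω : Ω) (B : Matrix (Fin p) (Fin p) ℝ), (∀ i j, |B i j| ≤ K) →
        |evalAt f (B * sampleCov (fun k : Fin N => g k ω) * Bᵀ) - evalAt f (B * Bᵀ) -
          ∑ i, ∑ j, linCoeff f B i j * gramDev g N ω i j| ≤ ρ N ω := by
  obtain ⟨C, D, hC, hCD⟩ := exists_abs_sub_linearization_le f hK
  set T : ℕ → Ω → Matrix (Fin p) (Fin p) ℝ := fun N ω => sampleCov (fun k : Fin N => g k ω) with hT
  set a : ℕ → ℝ := fun N => N / ((N : ℝ) - 1) with ha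
  -- For `N ≥ 2` one has `a N - 1 = 1 / (N - 1)`; for `N = 0` and `N = 1` the value of `a` is 0, the
  -- latter by division by zero.
  have hbound : ∀ N : ℕ, |a N| ≤ 2 ∧ |(N : ℝ) * (a N - 1)| ≤ 2 := by
    intro N
    rcases N with _ | _ | n
    · simp [ha]
    · simp [ha]
    · have e : ((n + 1 + 1 : ℕ) : ℝ) - 1 = n + 1 := by push_cast; ring
      have h0 : (0 : ℝ) < n + 1 := by positivity
      have e1 : a (n + 1 + 1) - 1 = 1 / ((n : ℝ) + 1) := by
        simp only [ha, e]
        field_simp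
        push_cast
        ring
      have e2 : a (n + 1 + 1) = 1 + 1 / ((n : ℝ) + 1) := by linarith
      have h1 : 1 / ((n : ℝ) + 1) ≤ 1 := by
        rw [div_le_one h0]; linarith [(Nat.cast_nonneg n : (0 : ℝ) ≤ n)]
      have h2 : 0 ≤ 1 / ((n : ℝ) + 1) := by positivity
      refine ⟨?_, ?_⟩
      · rw [e2, abs_of_nonneg (by linarith)]; linarith
      · rw [e1, abs_of_nonneg (by positivity)]
        push_cast
        have : ((n : ℝ) + 1 + 1) * (1 / (n + 1)) = 1 + 1 / (n + 1) := by field_simp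
        linarith
  have hsqrt : ∀ N : ℕ, √(N : ℝ) ≤ N := by
    intro N
    rcases Nat.eq_zero_or_pos N with rfl | hN
    · simp
    · have : (1 : ℝ) ≤ N := by exact_mod_cast hN
      rw [Real.sqrt_le_left (by linarith)]
      nlinarith
  have ba : MomentBounded P (fun N _ => a N) := momentBounded_of_le fun N => (hbound N).1
  have ba1 : MomentBounded P (fun N _ => a N - 1) := by
    refine momentBounded_of_le (K := 3) fun N => ?_
    have := abs_le.1 (hbound N).1
    exact abs_le.2 ⟨by linarith [this.1], by linarith [this.2]⟩
  have baN : MomentBounded P (fun N _ => (N : ℝ) * (a N - 1)) :=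
    momentBounded_of_le fun N => (hbound N).2
  have baS : MomentBounded P (fun (N : ℕ) _ => √(N : ℝ) * (a N - 1)) := by
    refine momentBounded_of_le (K := 2) fun N => le_trans ?_ (hbound N).2
    rw [abs_mul, abs_mul, abs_of_nonneg (Real.sqrt_nonneg _), Nat.abs_cast]
    exact mul_le_mul_of_nonneg_right (hsqrt N) (abs_nonneg _)
  have hone : ∀ N : ℕ, 0 < N → 1 ≤ √(N : ℝ) := fun N hN => by
    rw [Real.one_le_sqrt]; exact_mod_cast hN
  have bU := hg.momentBounded_gramDev
  have bM := hg.momentBounded_coordMean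
  have bU' : ∀ i j, MomentBounded P (fun N ω => gramDev g N ω i j) := by
    intro i j
    -- The added 1 covers `N = 0`, where `gramDev` is minus the identity while `√N` vanishes.
    refine ((bU i j).abs.add (momentBounded_const 1)).mono
      (fun N => (hg.measurable_gramDev N i j).aestronglyMeasurable) fun N ω => ?_
    rw [abs_of_nonneg (a := _ + _) (by positivity), abs_mul, abs_of_nonneg (Real.sqrt_nonneg _)]
    rcases Nat.eq_zero_or_pos N with rfl | hN
    · simp only [gramDev, of_apply, one_apply]
      split_ifs <;> simp
    · nlinarith [hone N hN, abs_nonneg (gramDev g N ω i j)]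
  have bM' : ∀ i, MomentBounded P (fun N ω => coordMean g N ω i) := by
    intro i
    refine (bM i).mono
      (fun N => (hg.measurable_coordMean N i).aestronglyMeasurable) fun N ω => ?_
    rw [abs_mul, abs_of_nonneg (Real.sqrt_nonneg _)]
    rcases Nat.eq_zero_or_pos N with rfl | hN
    · simp [coordMean]
    · nlinarith [hone N hN, abs_nonneg (coordMean g N ω i)]
  -- Replacing `T - 1` by `U` costs the factor `N / (N - 1)` and the product of coordinate means.
  -- Both errors are of order `1 / N`, the second because each mean is of order `1 / √N`.
  have hdiff : ∀ N ω i j, (T N ω - 1 - gramDev g N ω) i j =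
      (a N - 1) * (gramDev g N ω i j + (1 : Matrix (Fin p) (Fin p) ℝ) i j) +
        (-1) * (a N * (coordMean g N ω i * coordMean g N ω j)) := by
    intro N ω i j
    rw [Matrix.sub_apply, Matrix.sub_apply, hT]
    simp only
    rw [sampleCov_eq]
    ring
  have bδ : ∀ i j, MomentBounded P (fun N ω => gramDev g N ω i j +
      (1 : Matrix (Fin p) (Fin p) ℝ) i j) := fun i j => (bU' i j).add (momentBounded_const _)
  have bND : ∀ i j, MomentBounded P (fun N ω => N * (T N ω - 1 - gramDev g N ω) i j) := by
    intro i j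
    convert (baN.mul (bδ i j)).add
      ((momentBounded_const (-1)).mul (ba.mul ((bM i).mul (bM j)))) using 3 with N ω
    rw [hdiff]
    have : √(N : ℝ) * √(N : ℝ) = N := Real.mul_self_sqrt (Nat.cast_nonneg _)
    linear_combination (a N * coordMean g N ω i * coordMean g N ω j) * this
  have bD : ∀ i j, MomentBounded P (fun N ω => (T N ω - 1 - gramDev g N ω) i j) := by
    intro i j
    simp only [hdiff]
    exact (ba1.mul (bδ i j)).add
      ((momentBounded_const (-1)).mul (ba.mul ((bM' i).mul (bM' j))))
  have bSD : ∀ i j, MomentBounded P (fun (N : ℕ) ω =>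
      √(N : ℝ) * (T N ω - 1 - gramDev g N ω) i j) := by
    intro i j
    refine (bND i j).mono (fun N => (bD i j).1 N |>.const_mul _) fun N ω => ?_
    rw [abs_mul, abs_mul, abs_of_nonneg (Real.sqrt_nonneg _), Nat.abs_cast]
    exact mul_le_mul_of_nonneg_right (hsqrt N) (abs_nonneg _)
  have bH : ∀ i j, MomentBounded P (fun N ω => (T N ω - 1) i j) := by
    intro i j
    convert (bU' i j).add (bD i j) using 3 with N ω
    rw [Matrix.sub_apply (T N ω - 1)]
    ring
  have bSH : ∀ i j, MomentBounded P (fun (N : ℕ) ω => √(N : ℝ) * (T N ω - 1) i j) := by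
    intro i j
    convert (bU i j).add (bSD i j) using 3 with N ω
    rw [Matrix.sub_apply (T N ω - 1)]
    ring
  have bη : MomentBounded P (fun N ω => ∑ i, ∑ j, |(T N ω - 1) i j|) :=
    MomentBounded.sum _ fun i _ => MomentBounded.sum _ fun j _ => (bH i j).abs
  have bSη : MomentBounded P (fun (N : ℕ) ω => √(N : ℝ) * ∑ i, ∑ j, |(T N ω - 1) i j|) := by
    convert MomentBounded.sum Finset.univ fun i _ =>
      MomentBounded.sum Finset.univ fun j _ => (bSH i j).abs using 3 with N ω
    simp only [Finset.mul_sum, abs_mul, abs_of_nonneg (Real.sqrt_nonneg _)]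
  have bNθ : MomentBounded P (fun N ω => N * ∑ i, ∑ j, |(T N ω - 1 - gramDev g N ω) i j|) := by
    convert MomentBounded.sum Finset.univ fun i _ =>
      MomentBounded.sum Finset.univ fun j _ => (bND i j).abs using 3 with N ω
    simp only [Finset.mul_sum, abs_mul, Nat.abs_cast]
  refine ⟨fun N ω => C * ((1 + ∑ i, ∑ j, |(T N ω - 1) i j|) ^ D *
      (∑ i, ∑ j, |(T N ω - 1) i j|) ^ 2 + ∑ i, ∑ j, |(T N ω - 1 - gramDev g N ω) i j|), ?_,
    fun N ω B hB => hCD B _ _ hB⟩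
  -- The factor `N` is spent on the squared deviation as `(√N η) ^ 2`.
  convert (momentBounded_const C).mul
    (((((momentBounded_const 1).add bη).pow D).mul (bSη.pow 2)).add bNθ) using 3 with N ω
  rw [mul_pow (√(N : ℝ)), Real.sq_sqrt (Nat.cast_nonneg _)]
  ring

end Sample

/-! ### Variances under small perturbations. -/

section Variance

variable {Ω : Type*} [MeasurableSpace Ω] {P : Measure Ω}

lemma MomentBounded.exists_integral_sq_le {W : ℕ → Ω → ℝ} (hW : MomentBounded P W) :
    ∃ C : ℝ, ∀ N, ∫ ω, W N ω ^ 2 ∂P ≤ C := by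
  obtain ⟨C, hC⟩ := hW.2 2 two_ne_zero
  refine ⟨(C : ℝ) ^ 2, fun N => ?_⟩
  have h := hC N
  have hm := hW.memLp N two_ne_zero
  rw [hm.eLpNorm_eq_integral_rpow_norm (by simp) (by simp)] at h
  have h2 := ENNReal.toReal_mono ENNReal.coe_ne_top h
  have hnn : 0 ≤ ∫ ω, W N ω ^ 2 ∂P := integral_nonneg fun ω => sq_nonneg _
  have e : ∀ ω, ‖W N ω‖ ^ ((2 : ℕ) : ℝ≥0∞).toReal = W N ω ^ 2 := fun ω => by
    simp [Real.norm_eq_abs]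
  simp_rw [e] at h2
  rw [ENNReal.toReal_ofReal (by positivity), ENNReal.coe_toReal, ENNReal.toReal_natCast] at h2
  have h3 := pow_le_pow_left₀ (by positivity) h2 2
  rwa [← Real.rpow_natCast (_ ^ _) 2, ← Real.rpow_mul hnn, inv_mul_cancel₀ (by norm_num),
    Real.rpow_one] at h3

/-- A sequence with bounded moments is negligible after division by `√N`. -/
lemma MomentBounded.tendsto_eLpNorm {ρ : ℕ → Ω → ℝ} (h : MomentBounded P fun N ω => N * ρ N ω) :
    Tendsto (fun N : ℕ => eLpNorm (fun ω => √(N : ℝ) * ρ N ω) 2 P) atTop (𝓝 0) := by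
  obtain ⟨C, hC⟩ := h.2 2 two_ne_zero
  have h1 : Tendsto (fun N : ℕ => ENNReal.ofReal ((√(N : ℝ))⁻¹ * C)) atTop (𝓝 0) := by
    rw [← ENNReal.ofReal_zero]
    refine ENNReal.tendsto_ofReal ?_
    rw [← zero_mul (C : ℝ)]
    exact (tendsto_inv_atTop_zero.comp
      (Real.tendsto_sqrt_atTop.comp tendsto_natCast_atTop_atTop)).mul_const _
  refine tendsto_of_tendsto_of_tendsto_of_le_of_le' tendsto_const_nhds h1
    (Eventually.of_forall fun _ => zero_le) ?_
  filter_upwards [eventually_gt_atTop 0] with N hN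
  have hN' : (0 : ℝ) < N := by exact_mod_cast hN
  have hs : 0 < √(N : ℝ) := Real.sqrt_pos.2 hN'
  have e : (fun ω => √(N : ℝ) * ρ N ω) = (√(N : ℝ))⁻¹ • fun ω => N * ρ N ω := by
    ext ω
    simp only [Pi.smul_apply, smul_eq_mul]
    rw [← mul_assoc]
    congr 1
    rw [eq_inv_mul_iff_mul_eq₀ hs.ne', Real.mul_self_sqrt hN'.le]
  rw [e, eLpNorm_const_smul, ENNReal.ofReal_mul (by positivity), Real.enorm_of_nonneg
    (by positivity), ENNReal.ofReal_coe_nnreal]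
  exact mul_le_mul_right (hC N) _

variable [IsProbabilityMeasure P]

/-- Cauchy–Schwarz, from the discriminant of the nonnegative quadratic `t ↦ Var[X + t Y]`. -/
lemma covariance_sq_le {X Y : Ω → ℝ} (hX : MemLp X 2 P) (hY : MemLp Y 2 P) :
    cov[X, Y; P] ^ 2 ≤ Var[X; P] * Var[Y; P] := by
  have h := discrim_le_zero (a := Var[Y; P]) (b := 2 * cov[X, Y; P]) (c := Var[X; P]) fun t => by
    have h1 := variance_nonneg (fun ω => X ω + t * Y ω) P
    rw [variance_fun_add hX (hY.const_mul t), variance_const_mul, covariance_const_mul_right] at h1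
    linarith
  rw [discrim] at h
  linarith

/-- Allows the Taylor remainder `Y` to be dropped from a variance. -/
lemma abs_variance_add_sub_le {X Y : Ω → ℝ} (hX : MemLp X 2 P) (hY : MemLp Y 2 P) :
    |Var[fun ω => X ω + Y ω; P] - Var[X; P]| ≤ 2 * √(Var[X; P] * Var[Y; P]) + Var[Y; P] := by
  rw [variance_fun_add hX hY, show ∀ a b c : ℝ, a + 2 * b + c - a = 2 * b + c by intros; ring]
  refine (abs_add_le _ _).trans (add_le_add ?_ (abs_of_nonneg (variance_nonneg _ _)).le)
  rw [abs_mul, abs_two]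
  exact mul_le_mul_of_nonneg_left (Real.abs_le_sqrt (covariance_sq_le hX hY)) zero_le_two

end Variance

/-! ### The asymptotic variance: continuity and positivity. -/

section AsymptoticVariance

variable {p : ℕ}

/-- The quadratic form with coefficients `c`. -/
def quadForm (c : Fin p → Fin p → ℝ) (x : EuclideanSpace ℝ (Fin p)) : ℝ :=
  ∑ i, ∑ j, c i j * (x i * x j)

lemma continuous_quadForm (c : Fin p → Fin p → ℝ) : Continuous (quadForm c) := by
  unfold quadForm
  fun_prop

lemma memLp_quadForm (c : Fin p → Fin p → ℝ) (q : ℕ) :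
    MemLp (quadForm c) q (stdGaussian (EuclideanSpace ℝ (Fin p))) :=
  memLp_finsetSum _ fun i _ => memLp_finsetSum _ fun j _ =>
    (memLp_mul_apply_stdGaussian i j q).const_mul _

lemma integral_quadForm (c : Fin p → Fin p → ℝ) :
    ∫ x, quadForm c x ∂(stdGaussian (EuclideanSpace ℝ (Fin p))) =
      ∑ i, ∑ j, c i j * (1 : Matrix (Fin p) (Fin p) ℝ) i j := by
  have h : ∀ i j, Integrable (fun x : EuclideanSpace ℝ (Fin p) => c i j * (x i * x j))
      (stdGaussian (EuclideanSpace ℝ (Fin p))) := fun i j =>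
    ((memLp_mul_apply_stdGaussian i j 1).integrable (by simp)).const_mul _
  unfold quadForm
  rw [integral_finsetSum _ fun i _ => integrable_finsetSum _ fun j _ => h i j]
  refine Finset.sum_congr rfl fun i _ => ?_
  rw [integral_finsetSum _ fun j _ => h i j]
  refine Finset.sum_congr rfl fun j _ => ?_
  rw [integral_const_mul, integral_mul_apply_stdGaussian]

/-- The variance of a quadratic form in a standard normal random vector. -/
def quadVar (c : Fin p → Fin p → ℝ) : ℝ :=
  Var[quadForm c; stdGaussian (EuclideanSpace ℝ (Fin p))]

/-- By bilinearity of covariance, `quadVar` is a quadratic polynomial in the coefficients. -/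
lemma continuous_quadVar : Continuous fun c : Fin p → Fin p → ℝ => quadVar c := by
  set m : Fin p × Fin p → EuclideanSpace ℝ (Fin p) → ℝ := fun a x => x a.1 * x a.2 with hm
  have hL : ∀ a, MemLp (m a) 2 (stdGaussian (EuclideanSpace ℝ (Fin p))) := fun a =>
    memLp_mul_apply_stdGaussian a.1 a.2 2
  have h : ∀ c : Fin p → Fin p → ℝ, quadVar c = ∑ a, ∑ b, c b.1 b.2 * (c a.1 a.2 *
      cov[m a, m b; stdGaussian (EuclideanSpace ℝ (Fin p))]) := by
    intro c
    have e : quadForm c = fun x => ∑ a : Fin p × Fin p, c a.1 a.2 * m a x := by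
      ext x
      rw [quadForm, Fintype.sum_prod_type]
    rw [quadVar, e, variance_fun_sum fun a => (hL a).const_mul _]
    simp only [covariance_const_mul_left, covariance_const_mul_right]
  simp only [h]
  fun_prop

instance isOpenPosMeasure_gaussianReal : (gaussianReal 0 1).IsOpenPosMeasure :=
  (gaussianReal_absolutelyContinuous' 0 one_ne_zero).isOpenPosMeasure

/-- Full support is what upgrades almost sure equality of continuous functions to equality
everywhere. -/
instance isOpenPosMeasure_stdGaussian :
    (stdGaussian (EuclideanSpace ℝ (Fin p))).IsOpenPosMeasure := by
  rw [← map_pi_eq_stdGaussian]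
  exact (PiLp.continuous_toLp 2 _).isOpenPosMeasure_map (WithLp.toLp_surjective 2)

/-- The case `H = x xᵗ` of `sum_mul_gradAt_eq`, since `B x xᵗ Bᵗ = (B x)(B x)ᵗ`. -/
lemma quadForm_linCoeff (f : MvPolynomial (Entry p) ℝ) (B : Matrix (Fin p) (Fin p) ℝ)
    (x : EuclideanSpace ℝ (Fin p)) :
    quadForm (linCoeff f B) x =
      ∑ q : Entry p, (B *ᵥ x.ofLp) q.1.1 * (B *ᵥ x.ofLp) q.1.2 * gradAt f (B * Bᵀ) q := by
  have h := sum_mul_gradAt_eq f B (vecMulVec x.ofLp x.ofLp)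
  rw [mul_vecMulVec, vecMulVec_mul, vecMul_transpose] at h
  exact h.symm

/-- Polarization: the values at `e_a + e_b`, `e_a` and `e_b` isolate the coefficient of `y_a y_b`.
-/
lemma eq_zero_of_forall_sum_mul_eq_zero {G : Entry p → ℝ}
    (h : ∀ y : Fin p → ℝ, ∑ q : Entry p, y q.1.1 * y q.1.2 * G q = 0) : G = 0 := by
  funext q₀
  obtain ⟨⟨a, b⟩, hab⟩ := q₀
  have h1 := h (Pi.single a 1 + Pi.single b 1)
  have h2 := h (Pi.single a 1)
  have h3 := h (Pi.single b 1)
  have h4 : ∑ q : Entry p, ((Pi.single a (1 : ℝ) : Fin p → ℝ) q.1.1 *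
      (Pi.single b (1 : ℝ) : Fin p → ℝ) q.1.2 + (Pi.single b (1 : ℝ) : Fin p → ℝ) q.1.1 *
        (Pi.single a (1 : ℝ) : Fin p → ℝ) q.1.2) * G q = 0 := by
    rw [← sub_self (0 : ℝ), ← sub_zero ((0 : ℝ) - 0)]
    nth_rewrite 1 [← h1]
    nth_rewrite 1 [← h2]
    nth_rewrite 1 [← h3]
    rw [← Finset.sum_sub_distrib, ← Finset.sum_sub_distrib]
    refine Finset.sum_congr rfl fun q _ => ?_
    simp only [Pi.add_apply]
    ring
  rw [Finset.sum_eq_single (⟨(a, b), hab⟩ : Entry p)] at h4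
  · simp only [Pi.single_eq_same, mul_one] at h4
    -- The factor of the surviving coefficient is 1 off the diagonal and 2 on it.
    have : (0 : ℝ) < 1 + (Pi.single b (1 : ℝ) : Fin p → ℝ) a * (Pi.single a (1 : ℝ) : Fin p → ℝ) b := by
      simp only [Pi.single_apply]
      split_ifs <;> norm_num
    exact (mul_eq_zero.1 h4).resolve_left this.ne'
  · rintro ⟨⟨c, d⟩, hcd⟩ _ hne
    have e1 : ¬ (c = a ∧ d = b) := fun ⟨h5, h6⟩ => hne (by subst h5 h6; rfl)
    have e2 : ¬ (c = b ∧ d = a) := by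
      rintro ⟨rfl, rfl⟩
      have : c = d := le_antisymm hcd hab
      subst this
      exact e1 ⟨rfl, rfl⟩
    have h5 : ∀ u v : Fin p, ¬ (c = u ∧ d = v) →
        (Pi.single u (1 : ℝ) : Fin p → ℝ) c * (Pi.single v (1 : ℝ) : Fin p → ℝ) d = 0 := by
      intro u v huv
      rcases not_and_or.1 huv with h6 | h6 <;> simp [Pi.single_eq_of_ne h6]
    rw [h5 a b e1, h5 b a e2]
    simp
  · simp

/-- The asymptotic variance is positive where the gradient does not vanish. -/
lemma quadVar_linCoeff_pos {f : MvPolynomial (Entry p) ℝ} {B : Matrix (Fin p) (Fin p) ℝ}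
    (hB : IsUnit B) (hgrad : gradAt f (B * Bᵀ) ≠ 0) : 0 < quadVar (linCoeff f B) := by
  refine lt_of_le_of_ne (variance_nonneg _ _) fun h => hgrad ?_
  have h1 := ae_eq_integral_of_variance_eq_zero (memLp_quadForm (linCoeff f B) 2) h.symm
  -- Zero variance makes the quadratic form constant everywhere; its value at 0 then shows that it
  -- vanishes.
  have h2 := (Continuous.ae_eq_iff_eq _ (continuous_quadForm (linCoeff f B)) continuous_const).1 h1
  refine eq_zero_of_forall_sum_mul_eq_zero fun y => ?_
  -- Invertibility of `B` lets `B x` reach every vector `y`.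
  have h3 : B *ᵥ (B⁻¹ *ᵥ y) = y := by
    rw [mulVec_mulVec, mul_nonsing_inv _ ((isUnit_iff_isUnit_det B).1 hB), one_mulVec]
  have h4 := congrFun h2 (WithLp.toLp 2 (B⁻¹ *ᵥ y))
  rw [← congrFun h2 0, quadForm_linCoeff, h3] at h4
  rw [h4]
  simp [quadForm]

end AsymptoticVariance

/-! ### Limit theorems and Slutsky's argument. -/

section Asymptotics

variable {p : ℕ} {Ω : Type*}

/-- Exhibits the linear part as a centred mean of independent copies, ready for variance computation
and the central limit theorem. -/
lemma sum_mul_gramDev (c : Fin p → Fin p → ℝ) (g : ℕ → Ω → EuclideanSpace ℝ (Fin p)) (N : ℕ)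
    (ω : Ω) :
    ∑ i, ∑ j, c i j * gramDev g N ω i j = (1 / (N : ℝ)) * ∑ k ∈ Finset.range N, quadForm c (g k ω) -
      ∫ x, quadForm c x ∂(stdGaussian (EuclideanSpace ℝ (Fin p))) := by
  rw [integral_quadForm]
  simp only [gramDev, of_apply, mul_sub, Finset.sum_sub_distrib, quadForm]
  congr 1
  simp only [Finset.mul_sum]
  rw [Finset.sum_comm (s := Finset.range N)]
  refine Finset.sum_congr rfl fun i _ => ?_
  rw [Finset.sum_comm (s := Finset.range N)]
  exact Finset.sum_congr rfl fun j _ => Finset.sum_congr rfl fun k _ => by ring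

variable [MeasurableSpace Ω] {P : Measure Ω}
  {g : ℕ → Ω → EuclideanSpace ℝ (Fin p)}

lemma IsStdSample.memLp_quadForm (hg : IsStdSample P g) (c : Fin p → Fin p → ℝ) (k : ℕ) :
    MemLp (fun ω => quadForm c (g k ω)) 2 P := by
  have h := FactorAnalysis.memLp_quadForm c 2
  rw [Nat.cast_ofNat] at h
  exact hg.memLp_comp h k

lemma IsStdSample.memLp_sum_quadForm (hg : IsStdSample P g) (c : Fin p → Fin p → ℝ) (N : ℕ) :
    MemLp (fun ω => (1 / (N : ℝ)) * ∑ k ∈ Finset.range N, quadForm c (g k ω)) 2 P :=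
  (memLp_finsetSum (Finset.range N) (f := fun k ω => quadForm c (g k ω))
    fun k _ => hg.memLp_quadForm c k).const_mul _

variable [IsProbabilityMeasure P]

lemma IsStdSample.memLp_sum_mul_gramDev (hg : IsStdSample P g) (c : Fin p → Fin p → ℝ) (N : ℕ) :
    MemLp (fun ω => √(N : ℝ) * ∑ i, ∑ j, c i j * gramDev g N ω i j) 2 P := by
  simp only [sum_mul_gramDev]
  exact ((hg.memLp_sum_quadForm c N).sub (memLp_const _)).const_mul _

/-- The identity is exact for each positive `N`, so coefficients that vary with `N` cause no
difficulty. -/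
lemma IsStdSample.variance_sum_mul_gramDev (hg : IsStdSample P g) (c : Fin p → Fin p → ℝ) {N : ℕ}
    (hN : 0 < N) :
    Var[fun ω => √(N : ℝ) * ∑ i, ∑ j, c i j * gramDev g N ω i j; P] = quadVar c := by
  have hN' : (0 : ℝ) < N := by exact_mod_cast hN
  have hL : ∀ k, MemLp (fun ω => quadForm c (g k ω)) 2 P := fun k =>
    hg.memLp_quadForm c k
  have hsum := IndepFun.variance_sum (μ := P) (X := fun k ω => quadForm c (g k ω))
    (s := Finset.range N) (fun k _ => hL k) (fun i _ j _ hij =>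
      (hg.iIndepFun_comp (continuous_quadForm c).measurable).indepFun hij)
  have hvar : ∀ k, Var[fun ω => quadForm c (g k ω); P] = quadVar c := fun k => by
    rw [quadVar, ← hg.map_eq k, variance_map (continuous_quadForm c).measurable.aemeasurable
      (hg.measurable k).aemeasurable]
    rfl
  simp only [hvar, Finset.sum_const, Finset.card_range, nsmul_eq_mul] at hsum
  have e : (∑ k ∈ Finset.range N, fun ω => quadForm c (g k ω)) =
      fun ω => ∑ k ∈ Finset.range N, quadForm c (g k ω) := by
    ext ω
    simp
  rw [e] at hsum
  simp only [sum_mul_gramDev]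
  rw [variance_const_mul, variance_sub_const, variance_const_mul, hsum, Real.sq_sqrt hN'.le]
  · field_simp
  · exact (hg.memLp_sum_quadForm c N).1

lemma measurable_evalAt_sampleCov {X : ℕ → Ω → EuclideanSpace ℝ (Fin p)}
    (hX : ∀ k, Measurable (X k)) (f : MvPolynomial (Entry p) ℝ) (N : ℕ)
    (B : Matrix (Fin p) (Fin p) ℝ) :
    Measurable fun ω => evalAt f (B * sampleCov (fun k : Fin N => X k ω) * Bᵀ) := by
  have h : Continuous fun x : Fin N → EuclideanSpace ℝ (Fin p) => B * sampleCov x * Bᵀ :=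
    (continuous_const.matrix_mul continuous_sampleCov).matrix_mul continuous_const
  exact ((continuous_evalAt f).comp h).measurable.comp
    (measurable_pi_lambda _ fun k : Fin N => hX k)

/-- If `A N` tends to `Ψ`, then `N` times the variance of the sample invariant at `A N` tends to the
asymptotic variance at `Ψ`. -/
lemma IsStdSample.tendsto_mul_varInvariant (hg : IsStdSample P g) (f : MvPolynomial (Entry p) ℝ)
    {A : ℕ → Matrix (Fin p) (Fin p) ℝ} (hA : ∀ N, (A N).PosSemidef)
    {Ψ : Matrix (Fin p) (Fin p) ℝ} (hΨ : Ψ.PosSemidef) (hlim : Tendsto A atTop (𝓝 Ψ)) :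
    Tendsto (fun N : ℕ => (N : ℝ) * varInvariant f N (A N)) atTop
      (𝓝 (quadVar (linCoeff f (CFC.sqrt Ψ)))) := by
  set B : ℕ → Matrix (Fin p) (Fin p) ℝ := fun N => CFC.sqrt (A N) with hB
  have hBlim : Tendsto B atTop (𝓝 (CFC.sqrt Ψ)) :=
    (continuousOn_sqrt Ψ hΨ).tendsto.comp
      (tendsto_nhdsWithin_iff.2 ⟨hlim, Eventually.of_forall hA⟩)
  have hBij : ∀ i j, Tendsto (fun N => B N i j) atTop (𝓝 (CFC.sqrt Ψ i j)) := fun i j =>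
    ((continuous_id.matrix_elem i j).tendsto _).comp hBlim
  -- The extra 1 leaves room for the entries of `B N` near the limit, so one `ρ` serves all large
  -- `N`.
  set K : ℝ := 1 + ∑ i, ∑ j, |CFC.sqrt Ψ i j| with hK
  have hK0 : 0 ≤ K := by positivity
  have hBK : ∀ᶠ N in atTop, ∀ i j, |B N i j| ≤ K := by
    simp only [eventually_all]
    intro i j
    refine (((hBij i j).abs).eventually_lt_const ?_).mono fun N => le_of_lt
    have h1 : |CFC.sqrt Ψ i j| ≤ ∑ j, |CFC.sqrt Ψ i j| :=
      Finset.single_le_sum (f := fun j => |CFC.sqrt Ψ i j|) (fun _ _ => abs_nonneg _)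
        (Finset.mem_univ j)
    have h2 : ∑ j, |CFC.sqrt Ψ i j| ≤ ∑ i, ∑ j, |CFC.sqrt Ψ i j| :=
      Finset.single_le_sum (f := fun i => ∑ j, |CFC.sqrt Ψ i j|)
        (fun _ _ => Finset.sum_nonneg fun _ _ => abs_nonneg _) (Finset.mem_univ i)
    linarith
  obtain ⟨ρ, hρ, hbound⟩ := hg.exists_remainder_bound f hK0
  obtain ⟨C, hC⟩ := hρ.exists_integral_sq_le
  have hv : Tendsto (fun N => quadVar (linCoeff f (B N))) atTop
      (𝓝 (quadVar (linCoeff f (CFC.sqrt Ψ)))) := by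
    have hc : Continuous fun B : Matrix (Fin p) (Fin p) ℝ => quadVar (linCoeff f B) :=
      continuous_quadVar.comp
        (continuous_pi fun i => continuous_pi fun j => continuous_linCoeff f i j)
    exact (hc.tendsto _).comp hBlim
  have hCN : Tendsto (fun N : ℕ => C / (N : ℝ)) atTop (𝓝 0) :=
    tendsto_const_nhds.div_atTop tendsto_natCast_atTop_atTop
  have herr : Tendsto (fun N : ℕ => 2 * √(quadVar (linCoeff f (B N)) * (C / N)) + C / N) atTop
      (𝓝 0) := by
    have h1 := ((Real.continuous_sqrt.tendsto _).comp (hv.mul hCN)).const_mul 2 |>.add hCN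
    simpa using h1
  have hkey : ∀ᶠ N : ℕ in atTop, |(N : ℝ) * varInvariant f N (A N) - quadVar (linCoeff f (B N))| ≤
      2 * √(quadVar (linCoeff f (B N)) * (C / N)) + C / N := by
    filter_upwards [hBK, eventually_gt_atTop 0] with N hBN hN
    have hN' : (0 : ℝ) < N := by exact_mod_cast hN
    have hN1 : (1 : ℝ) ≤ N := by exact_mod_cast hN
    set X : Ω → ℝ := fun ω => √(N : ℝ) * ∑ i, ∑ j, linCoeff f (B N) i j * gramDev g N ω i j
    set R : Ω → ℝ := fun ω => evalAt f (B N * sampleCov (fun k : Fin N => g k ω) * (B N)ᵀ) -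
      evalAt f (B N * (B N)ᵀ) - ∑ i, ∑ j, linCoeff f (B N) i j * gramDev g N ω i j with hR
    set Y : Ω → ℝ := fun ω => √(N : ℝ) * R ω with hY
    have hX : MemLp X 2 P := hg.memLp_sum_mul_gramDev _ N
    have hf := measurable_evalAt_sampleCov hg.measurable f N (B N)
    have hYm : Measurable Y := by
      refine Measurable.const_mul ((hf.sub_const _).sub ?_) _
      exact Finset.measurable_sum _ fun i _ => Finset.measurable_sum _ fun j _ =>
        (hg.measurable_gramDev N i j).const_mul _
    have hYsq : ∀ ω, Y ω ^ 2 ≤ (N : ℝ)⁻¹ * (N * ρ N ω) ^ 2 := fun ω => by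
      have h1 : R ω ^ 2 ≤ ρ N ω ^ 2 := by
        rw [← sq_abs]
        exact pow_le_pow_left₀ (abs_nonneg _) (hbound N ω (B N) hBN) 2
      rw [hY, mul_pow, mul_pow, Real.sq_sqrt hN'.le]
      have : (N : ℝ)⁻¹ * ((N : ℝ) ^ 2 * ρ N ω ^ 2) = N * ρ N ω ^ 2 := by field_simp
      rw [this]
      exact mul_le_mul_of_nonneg_left h1 hN'.le
    have hρint : Integrable (fun ω => (N * ρ N ω) ^ 2) P := (hρ.memLp N two_ne_zero).integrable_sq
    have hYint : Integrable (fun ω => Y ω ^ 2) P := by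
      refine (hρint.const_mul (N : ℝ)⁻¹).mono' (hYm.pow_const 2).aestronglyMeasurable
        (ae_of_all _ fun ω => ?_)
      rw [Real.norm_eq_abs, abs_of_nonneg (sq_nonneg _)]
      exact hYsq ω
    have hYL : MemLp Y 2 P := (memLp_two_iff_integrable_sq hYm.aestronglyMeasurable).2 hYint
    have hvarY : Var[Y; P] ≤ C / N := by
      refine (variance_le_expectation_sq hYm.aestronglyMeasurable).trans ?_
      refine (integral_mono hYint (hρint.const_mul _) hYsq).trans ?_
      rw [integral_const_mul, inv_mul_eq_div]
      exact div_le_div_of_nonneg_right (hC N) hN'.le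
    have hvarX : Var[X; P] = quadVar (linCoeff f (B N)) := hg.variance_sum_mul_gramDev _ hN
    -- The constant `f(B Bᵗ)` drops out of the variance, so `f` need not vanish at `A N`.
    have hmain : (N : ℝ) * varInvariant f N (A N) = Var[fun ω => X ω + Y ω; P] := by
      rw [varInvariant_eq_variance_of_hasLaw hg.measurable hg.indep hg.map_eq]
      have e : (fun ω => X ω + Y ω) = fun ω => √(N : ℝ) *
          evalAt f (B N * sampleCov (fun k : Fin N => g k ω) * (B N)ᵀ) -
            √(N : ℝ) * evalAt f (B N * (B N)ᵀ) := by
        ext ω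
        simp only [X, hY, hR]
        ring
      rw [e, variance_sub_const (hf.const_mul _).aestronglyMeasurable, variance_const_mul,
        Real.sq_sqrt hN'.le]
    rw [hmain, ← hvarX]
    refine (abs_variance_add_sub_le hX hYL).trans ?_
    have := variance_nonneg X P
    gcongr
  have hdiff : Tendsto (fun N : ℕ => (N : ℝ) * varInvariant f N (A N) -
      quadVar (linCoeff f (B N))) atTop (𝓝 0) :=
    squeeze_zero_norm' hkey herr
  simpa using hdiff.add hv

/-- The sample covariance matrices of a standard sample converge almost surely to the identity. -/
lemma IsStdSample.ae_tendsto_sampleCov (hg : IsStdSample P g) :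
    ∀ᵐ ω ∂P, Tendsto (fun N : ℕ => sampleCov fun k : Fin N => g k ω) atTop
      (𝓝 (1 : Matrix (Fin p) (Fin p) ℝ)) := by
  have hslln : ∀ φ : EuclideanSpace ℝ (Fin p) → ℝ, Measurable φ →
      MemLp φ (1 : ℕ) (stdGaussian (EuclideanSpace ℝ (Fin p))) → ∀ᵐ ω ∂P,
        Tendsto (fun N : ℕ => (1 / (N : ℝ)) * ∑ k ∈ Finset.range N, φ (g k ω)) atTop
          (𝓝 (∫ x, φ x ∂(stdGaussian (EuclideanSpace ℝ (Fin p))))) := by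
    intro φ hφ hL
    have h := strong_law_ae_real (μ := P) (fun k ω => φ (g k ω))
      ((hg.memLp_comp hL 0).integrable (by simp))
      (fun i j hij => (hg.iIndepFun_comp hφ).indepFun hij) (hg.identDistrib hφ)
    rw [hg.integral_comp hφ 0] at h
    filter_upwards [h] with ω hω
    simpa only [one_div, inv_mul_eq_div] using hω
  have h1 : ∀ᵐ ω ∂P, ∀ i j, Tendsto (fun N : ℕ => gramDev g N ω i j) atTop (𝓝 0) := by
    rw [ae_all_iff]; intro i
    rw [ae_all_iff]; intro j
    filter_upwards [hslln (fun x => x i * x j) (by fun_prop) (memLp_mul_apply_stdGaussian i j 1)]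
      with ω hω
    rw [integral_mul_apply_stdGaussian] at hω
    have h := hω.sub_const ((1 : Matrix (Fin p) (Fin p) ℝ) i j)
    rw [sub_self] at h
    exact h
  have h2 : ∀ᵐ ω ∂P, ∀ i, Tendsto (fun N : ℕ => coordMean g N ω i) atTop (𝓝 0) := by
    rw [ae_all_iff]; intro i
    filter_upwards [hslln (fun x => x i) (by fun_prop) (memLp_apply_stdGaussian i 1)] with ω hω
    rw [integral_apply_stdGaussian] at hω
    exact hω
  have h3 : Tendsto (fun N : ℕ => (N : ℝ) / ((N : ℝ) - 1)) atTop (𝓝 1) := by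
    simpa [sub_eq_add_neg] using tendsto_natCast_div_add_atTop (-1 : ℝ)
  filter_upwards [h1, h2] with ω hU hM
  refine tendsto_pi_nhds.2 fun i => tendsto_pi_nhds.2 fun j => ?_
  simp only [sampleCov_eq]
  have := h3.mul (((hU i j).add_const ((1 : Matrix (Fin p) (Fin p) ℝ) i j)).sub
    ((hM i).mul (hM j)))
  simpa using this

/-- Central limit theorem for linear functions of the Gram matrix of a standard sample. -/
lemma IsStdSample.tendstoInDistribution_sum_mul_gramDev (hg : IsStdSample P g)
    (c : Fin p → Fin p → ℝ) :
    TendstoInDistribution (fun (N : ℕ) ω => √(N : ℝ) * ∑ i, ∑ j, c i j * gramDev g N ω i j) atTop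
      (fun z : ℝ => √(quadVar c) * z) (fun _ => P) (gaussianReal 0 1) := by
  have hv0 : 0 ≤ quadVar c := variance_nonneg _ _
  have hQ := (continuous_quadForm c).measurable
  have hvar : Var[fun ω => quadForm c (g 0 ω); P] = quadVar c := by
    rw [quadVar, ← hg.map_eq 0, variance_map hQ.aemeasurable (hg.measurable 0).aemeasurable]
    rfl
  have hlaw : HasLaw (fun z : ℝ => √(quadVar c) * z)
      (gaussianReal 0 Var[fun ω => quadForm c (g 0 ω); P].toNNReal) (gaussianReal 0 1) := by
    have h := gaussianReal_const_mul (HasLaw.id (μ := gaussianReal 0 1)) (√(quadVar c))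
    rw [hvar]
    have e : (quadVar c).toNNReal = NNReal.mk (√(quadVar c) ^ 2) (sq_nonneg _) * 1 := by
      ext
      simp [Real.sq_sqrt hv0, Real.coe_toNNReal _ hv0]
    rw [mul_zero, ← e] at h
    exact h
  have hclt := tendstoInDistribution_inv_sqrt_mul_sum_sub (X := fun k ω => quadForm c (g k ω)) hlaw
    (hg.memLp_quadForm c 0) (hg.iIndepFun_comp hQ) (hg.identDistrib hQ)
  refine hclt.congr (fun N => ae_of_all _ fun ω => ?_) (ae_of_all _ fun _ => rfl)
  simp only
  rw [sum_mul_gramDev, hg.integral_comp hQ 0]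
  rcases Nat.eq_zero_or_pos N with rfl | hN
  · simp
  have hN' : (0 : ℝ) < N := by exact_mod_cast hN
  have hs : √(N : ℝ) ≠ 0 := (Real.sqrt_pos.2 hN').ne'
  have hs2 : √(N : ℝ) * √(N : ℝ) = N := Real.mul_self_sqrt hN'.le
  field_simp
  rw [sq, hs2]

/-- Asymptotic normality of the sample invariant. -/
lemma IsStdSample.tendstoInDistribution_evalAt (hg : IsStdSample P g)
    (f : MvPolynomial (Entry p) ℝ) {B : Matrix (Fin p) (Fin p) ℝ}
    (hzero : evalAt f (B * Bᵀ) = 0) :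
    TendstoInDistribution (fun (N : ℕ) ω =>
        √(N : ℝ) * evalAt f (B * sampleCov (fun k : Fin N => g k ω) * Bᵀ)) atTop
      (fun z : ℝ => √(quadVar (linCoeff f B)) * z) (fun _ => P) (gaussianReal 0 1) := by
  set K : ℝ := ∑ i, ∑ j, |B i j| with hK
  have hK0 : 0 ≤ K := by positivity
  have hBK : ∀ i j, |B i j| ≤ K := fun i j => by
    have h1 : |B i j| ≤ ∑ j, |B i j| :=
      Finset.single_le_sum (f := fun j => |B i j|) (fun _ _ => abs_nonneg _) (Finset.mem_univ j)
    exact h1.trans (Finset.single_le_sum (f := fun i => ∑ j, |B i j|)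
        (fun _ _ => Finset.sum_nonneg fun _ _ => abs_nonneg _) (Finset.mem_univ i))
  obtain ⟨ρ, hρ, hbound⟩ := hg.exists_remainder_bound f hK0
  have hmeas : ∀ N : ℕ, Measurable fun ω =>
      √(N : ℝ) * evalAt f (B * sampleCov (fun k : Fin N => g k ω) * Bᵀ) := fun N =>
    (measurable_evalAt_sampleCov hg.measurable f N B).const_mul _
  refine tendstoInDistribution_of_tendstoInMeasure_sub _ _
    (hg.tendstoInDistribution_sum_mul_gramDev (linCoeff f B)) ?_ fun N => (hmeas N).aemeasurable
  refine tendstoInMeasure_of_tendsto_eLpNorm two_ne_zero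
    (fun N => ((hmeas N).aestronglyMeasurable.sub (hg.memLp_sum_mul_gramDev _ N).1))
    aestronglyMeasurable_const ?_
  refine tendsto_of_tendsto_of_tendsto_of_le_of_le tendsto_const_nhds hρ.tendsto_eLpNorm
    (fun _ => zero_le) fun N => eLpNorm_mono_real fun ω => ?_
  have h := hbound N ω B hBK
  rw [hzero, sub_zero] at h
  simp only [Pi.sub_apply, Pi.zero_apply, sub_zero]
  rw [← mul_sub, norm_mul, Real.norm_eq_abs, Real.norm_eq_abs, abs_of_nonneg (Real.sqrt_nonneg _)]
  exact mul_le_mul_of_nonneg_left h (Real.sqrt_nonneg _)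

/-- Settles `N = 0`, where the factor `√N` cannot be cancelled. -/
lemma standardizedInvariant_zero (f : MvPolynomial (Entry p) ℝ)
    (x : Fin 0 → EuclideanSpace ℝ (Fin p)) : standardizedInvariant f x = 0 := by
  have h : varInvariant f 0 (sampleCov x) = 0 := by
    have e : (fun x : Fin 0 → EuclideanSpace ℝ (Fin p) => evalAt f (sampleCov x)) =
        fun _ => evalAt f 0 := by
      ext x
      simp [sampleCov]
    rw [varInvariant, e, variance_eq_integral measurable_const.aemeasurable]
    simp
  rw [standardizedInvariant, h]
  simp

/-- Asymptotic normality of the standardized sample invariant, for a sample that is given as an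
affine image of a standard sample. -/
lemma IsStdSample.tendstoInDistribution_standardizedInvariant (hg : IsStdSample P g)
    (f : MvPolynomial (Entry p) ℝ) {Ψ : Matrix (Fin p) (Fin p) ℝ} (hΨ : Ψ.PosDef)
    (hzero : evalAt f Ψ = 0) (hgrad : gradAt f Ψ ≠ 0) (μ : EuclideanSpace ℝ (Fin p)) :
    TendstoInDistribution (fun (N : ℕ) ω => standardizedInvariant f
        fun k : Fin N => μ + toEuclideanCLM (𝕜 := ℝ) (CFC.sqrt Ψ) (g k ω)) atTop
      (id : ℝ → ℝ) (fun _ => P) (gaussianReal 0 1) := by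
  set B := CFC.sqrt Ψ with hB
  have hBB : B * Bᵀ = Ψ := by
    rw [hB, transpose_sqrt]
    exact CFC.sqrt_mul_sqrt_self Ψ hΨ.posSemidef.nonneg
  have hBu : IsUnit B := (CFC.isUnit_sqrt_iff Ψ hΨ.posSemidef.nonneg).2 hΨ.isUnit
  set v := quadVar (linCoeff f B) with hv
  have hvpos : 0 < v := quadVar_linCoeff_pos hBu (by rwa [hBB])
  set S : ℕ → Ω → Matrix (Fin p) (Fin p) ℝ := fun N ω =>
    B * sampleCov (fun k : Fin N => g k ω) * Bᵀ with hS
  have hSeq : ∀ N ω, sampleCov (fun k : Fin N =>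
      μ + toEuclideanCLM (𝕜 := ℝ) B (g k ω)) = S N ω := fun N ω => sampleCov_affine _ B μ
  have hSpsd : ∀ N ω, (S N ω).PosSemidef := fun N ω => by
    rw [← hSeq]
    exact posSemidef_sampleCov _
  have hSmeas : ∀ N i j, Measurable fun ω => S N ω i j := by
    intro N i j
    have h : Continuous fun x : Fin N → EuclideanSpace ℝ (Fin p) => (B * sampleCov x * Bᵀ) i j :=
      ((continuous_const.matrix_mul continuous_sampleCov).matrix_mul
        continuous_const).matrix_elem i j
    exact h.measurable.comp (measurable_pi_lambda _ fun k : Fin N => hg.measurable k)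
  have hVmeas : ∀ N : ℕ, Measurable fun ω => (√((N : ℝ) * varInvariant f N (S N ω)))⁻¹ := fun N =>
    ((measurable_varInvariant f N (hSmeas N) (hSpsd N)).const_mul _).sqrt.inv
  have hV : TendstoInMeasure P (fun (N : ℕ) ω => (√((N : ℝ) * varInvariant f N (S N ω)))⁻¹) atTop
      fun _ => (√v)⁻¹ := by
    refine tendstoInMeasure_of_tendsto_ae (fun N => (hVmeas N).aestronglyMeasurable) ?_
    -- For fixed `ω` the matrices `S N ω` form a deterministic sequence tending to `Ψ`, and
    -- `varInvariant` integrates over a separate sample; hence the deterministic limit applies.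
    filter_upwards [hg.ae_tendsto_sampleCov] with ω hω
    have h1 : Tendsto (fun N => S N ω) atTop (𝓝 Ψ) := by
      have h2 := (tendsto_const_nhds (x := B)).mul hω |>.mul (tendsto_const_nhds (x := Bᵀ))
      rwa [mul_one, hBB] at h2
    have h3 := hg.tendsto_mul_varInvariant f (fun N => hSpsd N ω) hΨ.posSemidef h1
    exact ((Real.continuous_sqrt.tendsto _).comp h3).inv₀ (Real.sqrt_pos.2 hvpos).ne'
  -- Slutsky: numerator and denominator are both scaled by `√N`, which cancels in the quotient
  -- below.
  have hmain := (hg.tendstoInDistribution_evalAt f (B := B) (by rwa [hBB])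
    ).continuous_comp_prodMk_of_tendstoInMeasure_const (g := fun z : ℝ × ℝ => z.1 * z.2)
      (by fun_prop) hV fun N => (hVmeas N).aemeasurable
  refine hmain.congr (fun N => ae_of_all _ fun ω => ?_) (ae_of_all _ fun z => ?_)
  · rcases Nat.eq_zero_or_pos N with rfl | hN
    · simp [standardizedInvariant_zero]
    · have hs : √(N : ℝ) ≠ 0 := (Real.sqrt_pos.2 (by exact_mod_cast hN)).ne'
      simp only [standardizedInvariant]
      rw [hSeq, Real.sqrt_mul (Nat.cast_nonneg _), mul_inv, div_eq_mul_inv]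
      field_simp
      rfl
  · have hs : √v ≠ 0 := (Real.sqrt_pos.2 hvpos).ne'
    simp only [id]
    rw [← hv, mul_right_comm, mul_inv_cancel₀ hs, one_mul]

end Asymptotics

end FactorAnalysis

end

/-! ### Reduction of a general normal sample to a standard one. -/

theorem proposition3p1 {p m : ℕ} (f : MvPolynomial (FactorAnalysis.Entry p) ℝ)
    (hf : FactorAnalysis.IsInvariant p m f)
    (Ψ : Matrix (Fin p) (Fin p) ℝ) (hΨ : Ψ.PosDef)
    (hzero : FactorAnalysis.evalAt f Ψ = 0) (hgrad : FactorAnalysis.gradAt f Ψ ≠ 0)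
    (μ : EuclideanSpace ℝ (Fin p))
    {Ω : Type*} [MeasurableSpace Ω] (P : MeasureTheory.Measure Ω)
    [MeasureTheory.IsProbabilityMeasure P]
    (X : ℕ → Ω → EuclideanSpace ℝ (Fin p))
    (hindep : ProbabilityTheory.iIndepFun X P)
    (hlaw : ∀ k, ProbabilityTheory.HasLaw (X k) (ProbabilityTheory.multivariateGaussian μ Ψ) P) :
    MeasureTheory.TendstoInDistribution
      (fun (N : ℕ) (ω : Ω) =>
        FactorAnalysis.standardizedInvariant f (fun k : Fin N => X k ω))
      Filter.atTop (id : ℝ → ℝ) (fun _ => P) (ProbabilityTheory.gaussianReal 0 1) := by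
  open MeasureTheory ProbabilityTheory Matrix MatrixOrder in
  set B := CFC.sqrt Ψ with hB
  have hdet : IsUnit B.det := (isUnit_iff_isUnit_det B).1
    ((CFC.isUnit_sqrt_iff Ψ hΨ.posSemidef.nonneg).2 hΨ.isUnit)
  -- Whitening map, the inverse of `x ↦ μ + B x`.
  set φ : EuclideanSpace ℝ (Fin p) → EuclideanSpace ℝ (Fin p) := fun x =>
    toEuclideanCLM (𝕜 := ℝ) B⁻¹ (x - μ) with hφ
  have hφm : Measurable φ := by fun_prop
  have hleft : ∀ x, φ (μ + toEuclideanCLM (𝕜 := ℝ) B x) = x := fun x => by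
    simp only [hφ, add_sub_cancel_left]
    rw [← ContinuousLinearMap.comp_apply, ← ContinuousLinearMap.mul_def, ← map_mul,
      nonsing_inv_mul B hdet, map_one, one_apply_eq_self]
  have hright : ∀ x, μ + toEuclideanCLM (𝕜 := ℝ) B (φ x) = x := fun x => by
    simp only [hφ]
    rw [← ContinuousLinearMap.comp_apply, ← ContinuousLinearMap.mul_def, ← map_mul,
      mul_nonsing_inv B hdet, map_one, one_apply_eq_self, add_sub_cancel]
  have hX : ∀ k, AEMeasurable (X k) P := fun k => (hlaw k).aemeasurable
  -- The `X k` are only almost everywhere measurable, so measurable versions are whitened; they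
  -- agree with the `X k` simultaneously for all `k` outside a null set.
  have hg : FactorAnalysis.IsStdSample P fun k ω => φ ((hX k).mk (X k) ω) := by
    refine ⟨fun k => hφm.comp (hX k).measurable_mk,
      (hindep.congr fun k => (hX k).ae_eq_mk).comp (fun _ => φ) fun _ => hφm, fun k => ?_⟩
    have h1 : P.map ((hX k).mk (X k)) = multivariateGaussian μ Ψ := by
      rw [← Measure.map_congr (hX k).ae_eq_mk, (hlaw k).map_eq]
    have h2 : P.map (fun ω => φ ((hX k).mk (X k) ω)) = (P.map ((hX k).mk (X k))).map φ :=
      (Measure.map_map hφm (hX k).measurable_mk).symm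
    rw [h2, h1, multivariateGaussian, Measure.map_map hφm (by fun_prop)]
    have h3 : (φ ∘ fun x => μ + toEuclideanCLM (𝕜 := ℝ) B x) = id := funext hleft
    rw [← hB, h3, Measure.map_id]
  refine (hg.tendstoInDistribution_standardizedInvariant f hΨ hzero hgrad μ).congr (fun N => ?_)
    (ae_of_all _ fun _ => rfl)
  filter_upwards [ae_all_iff.2 fun k => (hX k).ae_eq_mk] with ω hω
  simp only [← hB, hright, ← hω]
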